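/- Let $K$ be a field of characteristic zero. **Graphs and trees.** Let $\mathrm{Gr}(n)$ be the $K$-vector space freely generated by the connected acyclic graphs with vertex set $\{1,\dots,n\}$ and an orientation of each edge, and let $\mathrm{Tr}(n)$ be the $K$-vector space freely generated by the planar rooted binary (trivalent) trees whose leaves are labelled bijectively by $\{1,\dots,n\}$ (both are $0$ for $n=0$). For such $G$ and $T$, let $\beta_{G,T}$ send an edge of $G$ joining $a$ and $b$ to the lowest vertex (the one nearest the root) on the shortest path in $T$ between the leaves $a$ and $b$. Put $\langle G,T\rangle=\prod_{e}\operatorname{sgn}(e)$, the product over the edges $e$ of $G$, if $\beta_{G,T}$ is surjective onto the internal vertices of $T$, and $\langle G,T\rangle=0$ otherwise; here $\operatorname{sgn}(a\to b)=1$ if the leaf $a$ lies to the left of the leaf $b$ in $T$, and $-1$ otherwise. **The spaces $\bar{\mathbb E}(W)$ and $\bar{\mathbb L}(V)$.** Let $W=\bigoplus_{i\in\mathbb Z}W_i$ and $V=\bigoplus_{i\in\mathbb Z}V_i$ be graded $K$-vector spaces. The symmetric group $\Sigma_n$ acts on $\mathrm{Gr}(n)$ and $\mathrm{Tr}(n)$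 by relabelling, on $W^{\otimes n}$ and $V^{\otimes n}$ by permuting the factors with Koszul signs, and diagonally on the products $\mathrm{Gr}(n)\otimes W^{\otimes n}$ and $\mathrm{Tr}(n)\otimes V^{\otimes n}$. Set $$\bar{\mathbb E}(W)=\bigoplus_n \bigl(\mathrm{Gr}(n)\otimes W^{\otimes n}\bigr)\big/{\sim},\Sigma_n,\qquad \bar{\mathbb L}(V)=\bigoplus_n \bigl(\mathrm{Tr}(n)\otimes V^{\otimes n}\bigr)\big/{\sim},\Sigma_n,$$ the quotients of the $\Sigma_n$-coinvariants by the following relations. On $\mathrm{Gr}(n)$: a graph plus the same graph with one edge reversed is $0$ (arrow-reversing), and the sum of three graphs which agree except that on vertices $a,b,c$ they have the edges $a\to b\to c$, $b\to c\to a$ and $c\to a\to b$ respectively is $0$ (Arnold). On $\mathrm{Tr}(n)$: a tree plus the same tree with the two branches at one internal vertex exchanged is $0$ (anti-symmetry), and the sum of three trees which agree except that one subtree is $(T_1T_2)T_3$, $(T_2T_3)T_1$ and $(T_3T_1)T_2$ respectively is $0$ (Jacobi). These are the vector spaces underlying the cofree Lie coalgebra on $W$ (for $W$ concentrated in positive degrees)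 and the free Lie algebra on $V$. The $n$-th summand is said to have weight $n$; the degree of a class $[G\otimes w_1\otimes\cdots\otimes w_n]$ or $[T\otimes v_1\otimes\cdots\otimes v_n]$ with homogeneous $w_i$ or $v_i$ is the sum of their degrees. **Theorem.** Let $\langle-,-\rangle:W\times V\to K$ be a bilinear pairing with $\langle W_i,V_j\rangle=0$ for $i\neq j$ which is perfect in the sense that it has no kernel on either side (if $\langle w,v\rangle=0$ for all $v\in V$, then $w=0$; if $\langle w,v\rangle=0$ for all $w\in W$, then $v=0$). Then there is exactly one bilinear pairing $\bar{\mathbb E}(W)\times\bar{\mathbb L}(V)\to K$, the configuration pairing, for which classes of different weights pair to $0$ and $$\bigl\langle[G\otimes w_1\otimes\cdots\otimes w_n],[T\otimes v_1\otimes\cdots\otimes v_n]\bigr\rangle=\sum_{\sigma\in\Sigma_n}\varepsilon(\sigma;w)\,\langle\sigma G,T\rangle\prod_{i=1}^n\langle w_{\sigma^{-1}(i)},v_i\rangle$$ for all $n$, $G$, $T$, all homogeneous $w_1,\dots,w_n\in W$ and all $v_1,\dots,v_n\in V$, where $\varepsilon(\sigma;w)$ is the Koszul sign of reordering $w_1\otimes\cdots\otimes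 w_n$ into $w_{\sigma^{-1}(1)}\otimes\cdots\otimes w_{\sigma^{-1}(n)}$. This pairing is perfect: 1. it has no kernel on either side; 2. if $W$ and $V$ are finite-dimensional, then for every $n$ it identifies each of the weight $n$ summands of $\bar{\mathbb E}(W)$ and $\bar{\mathbb L}(V)$ with the linear dual of the other; 3. if $W$ and $V$ are concentrated in positive degrees and finite-dimensional in each degree, then for every $m$ it identifies each of the degree $m$ parts of $\bar{\mathbb E}(W)$ and $\bar{\mathbb L}(V)$ with the linear dual of the other. -/

import Mathlib

open scoped TensorProduct DirectSum

noncomputable section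

namespace LieGraph

/-! ### Graphs -/

/-- An `S`-graph: a connected acyclic graph with vertex set `S`, each of whose edges carries an
orientation.  The pair `(a, b)` in `edges` is an edge from `a` to `b`. -/
@[ext]
structure SGraph (S : Type*) where
  edges : Finset (S × S)
  asymm : ∀ a b, (a, b) ∈ edges → (b, a) ∉ edges
  isTree : (SimpleGraph.fromRel fun a b => (a, b) ∈ edges).IsTree

namespace SGraph

/-- Relabelling of the vertices of a graph: the vertex `s` becomes the vertex `σ s`. -/
def relabel {S : Type*} (σ : Equiv.Perm S) (G : SGraph S) : SGraph S where
  edges := G.edges.map (σ.prodCongr σ).toEmbedding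
  asymm := by
    intro a b h h'
    simp only [Finset.mem_map_equiv] at h h'
    exact G.asymm _ _ h h'
  isTree := by
    let e : (SimpleGraph.fromRel fun a b => (a, b) ∈ G.edges) ≃g
        (SimpleGraph.fromRel fun a b =>
          (a, b) ∈ G.edges.map (σ.prodCongr σ).toEmbedding) :=
      { toEquiv := σ
        map_rel_iff' := by
          intro a b
          simp [SimpleGraph.fromRel_adj, Finset.mem_map_equiv] }
    exact e.isTree_iff.mp G.isTree

/-- `ArrowReversed G H`: the graph `H` is obtained from `G` by reversing the orientation of a
single edge, from `a → b` to `b → a`. -/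
def ArrowReversed {S : Type*} (G H : SGraph S) : Prop :=
  ∃ (a b : S) (R : Set (S × S)), (a, b) ∉ R ∧ (b, a) ∉ R ∧
    (G.edges : Set (S × S)) = insert (a, b) R ∧ (H.edges : Set (S × S)) = insert (b, a) R

/-- `Arnold G₁ G₂ G₃`: the three graphs agree except that, on three vertices `a`, `b`, `c`, they
have the edges `a → b → c`, `b → c → a` and `c → a → b` respectively. -/
def Arnold {S : Type*} (G₁ G₂ G₃ : SGraph S) : Prop :=
  ∃ (a b c : S) (R : Set (S × S)),
    (∀ e ∈ ({(a, b), (b, c), (c, a)} : Set (S × S)), e ∉ R) ∧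
    (G₁.edges : Set (S × S)) = {(a, b), (b, c)} ∪ R ∧
    (G₂.edges : Set (S × S)) = {(b, c), (c, a)} ∪ R ∧
    (G₃.edges : Set (S × S)) = {(c, a), (a, b)} ∪ R

end SGraph

/-- `Gr(n)`: the vector space freely generated by the graphs with vertex set `Fin n`. -/
abbrev Gr (K : Type*) [Field K] (n : ℕ) : Type _ := SGraph (Fin n) →₀ K

/-- The subspace of `Gr(n)` spanned by the arrow-reversing and the Arnold expressions; the
quotient by it is `Eil(n)`. -/
def eilRelations (K : Type*) [Field K] (n : ℕ) : Submodule K (Gr K n) :=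
  Submodule.span K
    ({x | ∃ G H : SGraph (Fin n), G.ArrowReversed H ∧
        x = Finsupp.single G 1 + Finsupp.single H 1} ∪
     {x | ∃ G₁ G₂ G₃ : SGraph (Fin n), SGraph.Arnold G₁ G₂ G₃ ∧
        x = Finsupp.single G₁ 1 + Finsupp.single G₂ 1 + Finsupp.single G₃ 1})

/-! ### Trees -/

/-- The leaves of a planar binary tree, from left to right. -/
def leaves {S : Type*} : FreeMagma S → List S
  | .of s => [s]
  | .mul l r => leaves l ++ leaves r

/-- The internal (trivalent) vertices of a planar binary tree.  A vertex is named by the path which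
leads to it from the lowest vertex: `false` for a step to the left, `true` for one to the right. -/
def internalVertices {S : Type*} : FreeMagma S → Finset (List Bool)
  | .of _ => ∅
  | .mul l r =>
      insert [] ((internalVertices l).image (List.cons false) ∪
        (internalVertices r).image (List.cons true))

/-- The nadir (lowest vertex) of the shortest path between the leaves `a` and `b` of a planar
binary tree: if both leaves are in the same branch at the lowest vertex, then the path stays in that
branch; otherwise it passes through the lowest vertex. -/
def nadir {S : Type*} [DecidableEq S] : FreeMagma S → S → S → List Bool
  | .of _, _, _ => []
  | .mul l r, a, b =>
      if a ∈ leaves l ∧ b ∈ leaves l then false :: nadir l a b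
      else if a ∈ leaves r ∧ b ∈ leaves r then true :: nadir r a b
      else []

/-- An `S`-tree: a planar rooted binary tree whose leaves are labelled bijectively by `S`. -/
@[ext]
structure STree (S : Type*) where
  tree : FreeMagma S
  nodup : (leaves tree).Nodup
  complete : ∀ s, s ∈ leaves tree

theorem leaves_map {S T : Type*} (f : S → T) (t : FreeMagma S) :
    leaves (FreeMagma.map f t) = (leaves t).map f := by
  induction t using FreeMagma.recOnMul with
  | ih1 s => rfl
  | ih2 l r hl hr =>
      rw [map_mul]
      change leaves _ ++ leaves _ = List.map f (leaves l ++ leaves r)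
      rw [hl, hr, List.map_append]

/-- Relabelling of the leaves of a tree: the leaf `s` becomes the leaf `σ s`. -/
def STree.relabel {S : Type*} (σ : Equiv.Perm S) (T : STree S) : STree S where
  tree := FreeMagma.map σ T.tree
  nodup := by
    rw [leaves_map]
    exact T.nodup.map σ.injective
  complete s := by
    rw [leaves_map]
    exact List.mem_map.mpr ⟨σ.symm s, T.complete _, σ.apply_symm_apply s⟩

/-- The second tree is the first one with the two branches at one internal vertex exchanged. -/
inductive BranchSwap {S : Type*} : FreeMagma S → FreeMagma S → Prop
  | root (t₁ t₂ : FreeMagma S) : BranchSwap (t₁ * t₂) (t₂ * t₁)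
  | left {l l' : FreeMagma S} (r : FreeMagma S) :
      BranchSwap l l' → BranchSwap (l * r) (l' * r)
  | right (l : FreeMagma S) {r r' : FreeMagma S} :
      BranchSwap r r' → BranchSwap (l * r) (l * r')

/-- The three trees agree except that one subtree is `(t₁ t₂) t₃` in the first, `(t₂ t₃) t₁` in the
second and `(t₃ t₁) t₂` in the third. -/
inductive Jacobi {S : Type*} : FreeMagma S → FreeMagma S → FreeMagma S → Prop
  | root (t₁ t₂ t₃ : FreeMagma S) :
      Jacobi ((t₁ * t₂) * t₃) ((t₂ * t₃) * t₁) ((t₃ * t₁) * t₂)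
  | left {l l' l'' : FreeMagma S} (r : FreeMagma S) :
      Jacobi l l' l'' → Jacobi (l * r) (l' * r) (l'' * r)
  | right (l : FreeMagma S) {r r' r'' : FreeMagma S} :
      Jacobi r r' r'' → Jacobi (l * r) (l * r') (l * r'')

/-- `Tr(n)`: the vector space freely generated by the trees with leaves labelled by `Fin n`. -/
abbrev Tr (K : Type*) [Field K] (n : ℕ) : Type _ := STree (Fin n) →₀ K

/-- The subspace of `Tr(n)` spanned by the anti-symmetry and the Jacobi expressions; the quotient
by it is `Lie(n)`. -/
def lieRelations (K : Type*) [Field K] (n : ℕ) : Submodule K (Tr K n) :=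
  Submodule.span K
    ({x | ∃ T T' : STree (Fin n), BranchSwap T.tree T'.tree ∧
        x = Finsupp.single T 1 + Finsupp.single T' 1} ∪
     {x | ∃ T₁ T₂ T₃ : STree (Fin n), Jacobi T₁.tree T₂.tree T₃.tree ∧
        x = Finsupp.single T₁ 1 + Finsupp.single T₂ 1 + Finsupp.single T₃ 1})

/-! ### The configuration pairing of graphs and trees -/

/-- The sign of the edge `e` of a graph with respect to the tree `T`: `1` if the leaf at which `e`
begins is to the left of the leaf at which it ends, and `-1` otherwise. -/
def edgeSign {S : Type*} [DecidableEq S] (T : STree S) (e : S × S) : ℤ :=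
  if (leaves T.tree).idxOf e.1 < (leaves T.tree).idxOf e.2 then 1 else -1

/-- The configuration pairing `⟨G, T⟩` of a graph and a tree.  The map `β` sends an edge of `G`
to the nadir in `T` of the path between its end points; the pairing is the product of the signs of
the edges if `β` is onto the internal vertices of `T`, and `0` otherwise. -/
def configPairing {S : Type*} [DecidableEq S] (G : SGraph S) (T : STree S) : ℤ :=
  if ∀ v ∈ internalVertices T.tree, ∃ e ∈ G.edges, nadir T.tree e.1 e.2 = v then
    ∏ e ∈ G.edges, edgeSign T e
  else 0

/-! ### The spaces `Ē(W)` and `L̄(V)` -/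

/-- The Koszul sign of moving, for all `i`, a factor of degree `d i` from position `i` to position
`σ i`. -/
def koszulSign {n : ℕ} (d : Fin n → ℤ) (σ : Equiv.Perm (Fin n)) : ℤ :=
  ∏ i : Fin n, ∏ j : Fin n,
    if i < j ∧ σ j < σ i then ((Int.negOnePow (d i * d j) : ℤˣ) : ℤ) else 1

section Spaces

variable {K : Type*} [Field K] {W : Type*} [AddCommGroup W] [Module K W]

/-- The subspace of `Gr(n) ⊗ W^{⊗ n}` (written here as `W^{⊗ n} ⊗ Gr(n)`) by which the `n`-th
summand of `Ē(W)` is the quotient.  It is spanned by the products of arrow-reversing and Arnold expressions with tensors, and by the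
differences `σ (G ⊗ w) - G ⊗ w` for the diagonal action of the symmetric group, which acts on
`W^{⊗ n}` with Koszul signs. -/
def eRelations (𝒲 : ℤ → Submodule K W) (n : ℕ) :
    Submodule K ((⨂[K] _ : Fin n, W) ⊗[K] Gr K n) :=
  Submodule.span K
    ({x | ∃ r ∈ eilRelations K n, ∃ w : ⨂[K] _ : Fin n, W, x = w ⊗ₜ[K] r} ∪
     {x | ∃ (σ : Equiv.Perm (Fin n)) (G : SGraph (Fin n)) (d : Fin n → ℤ) (w : Fin n → W),
        (∀ i, w i ∈ 𝒲 (d i)) ∧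
        x = (koszulSign d σ : K) •
              ((PiTensorProduct.tprod K fun i => w (σ.symm i)) ⊗ₜ[K]
                Finsupp.single (G.relabel σ) (1 : K)) -
            PiTensorProduct.tprod K w ⊗ₜ[K] Finsupp.single G (1 : K)})

/-- The subspace of `Tr(n) ⊗ V^{⊗ n}` (written here as `V^{⊗ n} ⊗ Tr(n)`) by which the `n`-th
summand of `L̄(V)` is the quotient.  It is spanned by the products of anti-symmetry and Jacobi expressions with tensors, and by the
differences `σ (T ⊗ v) - T ⊗ v` for the diagonal action of the symmetric group, which acts on
`V^{⊗ n}` with Koszul signs. -/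
def lRelations (𝒱 : ℤ → Submodule K W) (n : ℕ) :
    Submodule K ((⨂[K] _ : Fin n, W) ⊗[K] Tr K n) :=
  Submodule.span K
    ({x | ∃ r ∈ lieRelations K n, ∃ v : ⨂[K] _ : Fin n, W, x = v ⊗ₜ[K] r} ∪
     {x | ∃ (σ : Equiv.Perm (Fin n)) (T : STree (Fin n)) (d : Fin n → ℤ) (v : Fin n → W),
        (∀ i, v i ∈ 𝒱 (d i)) ∧
        x = (koszulSign d σ : K) •
              ((PiTensorProduct.tprod K fun i => v (σ.symm i)) ⊗ₜ[K]
                Finsupp.single (T.relabel σ) (1 : K)) -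
            PiTensorProduct.tprod K v ⊗ₜ[K] Finsupp.single T (1 : K)})

/-- The weight `n` summand of `Ē(W)`. -/
def EWeight (𝒲 : ℤ → Submodule K W) (n : ℕ) : Type _ :=
  ((⨂[K] _ : Fin n, W) ⊗[K] Gr K n) ⧸ eRelations 𝒲 n

instance (𝒲 : ℤ → Submodule K W) (n : ℕ) : AddCommGroup (EWeight 𝒲 n) :=
  Submodule.Quotient.addCommGroup (eRelations 𝒲 n)

instance (𝒲 : ℤ → Submodule K W) (n : ℕ) : Module K (EWeight 𝒲 n) :=
  Submodule.Quotient.module (eRelations 𝒲 n)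

/-- The quotient map onto the weight `n` summand of `Ē(W)`. -/
def EWeight.mk (𝒲 : ℤ → Submodule K W) (n : ℕ) :
    ((⨂[K] _ : Fin n, W) ⊗[K] Gr K n) →ₗ[K] EWeight 𝒲 n :=
  (eRelations 𝒲 n).mkQ

/-- The weight `n` summand of `L̄(V)`. -/
def LWeight (𝒱 : ℤ → Submodule K W) (n : ℕ) : Type _ :=
  ((⨂[K] _ : Fin n, W) ⊗[K] Tr K n) ⧸ lRelations 𝒱 n

instance (𝒱 : ℤ → Submodule K W) (n : ℕ) : AddCommGroup (LWeight 𝒱 n) :=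
  Submodule.Quotient.addCommGroup (lRelations 𝒱 n)

instance (𝒱 : ℤ → Submodule K W) (n : ℕ) : Module K (LWeight 𝒱 n) :=
  Submodule.Quotient.module (lRelations 𝒱 n)

/-- The quotient map onto the weight `n` summand of `L̄(V)`. -/
def LWeight.mk (𝒱 : ℤ → Submodule K W) (n : ℕ) :
    ((⨂[K] _ : Fin n, W) ⊗[K] Tr K n) →ₗ[K] LWeight 𝒱 n :=
  (lRelations 𝒱 n).mkQ

/-- `Ē(W)`, the vector space underlying the cofree Lie coalgebra on the graded vector space `W`
with homogeneous parts `𝒲 i`. -/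
abbrev EBar (𝒲 : ℤ → Submodule K W) : Type _ := ⨁ n : ℕ, EWeight 𝒲 n

/-- `L̄(V)`, the vector space underlying the free Lie algebra on the graded vector space `V`
with homogeneous parts `𝒱 i`. -/
abbrev LBar (𝒱 : ℤ → Submodule K W) : Type _ := ⨁ n : ℕ, LWeight 𝒱 n

/-- The class `[G ⊗ w₁ ⊗ ⋯ ⊗ wₙ]` in `Ē(W)`. -/
def eClass (𝒲 : ℤ → Submodule K W) {n : ℕ} (G : SGraph (Fin n)) (w : Fin n → W) : EBar 𝒲 :=
  DirectSum.lof K ℕ (EWeight 𝒲) n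
    (EWeight.mk 𝒲 n (PiTensorProduct.tprod K w ⊗ₜ[K] Finsupp.single G (1 : K)))

/-- The class `[T ⊗ v₁ ⊗ ⋯ ⊗ vₙ]` in `L̄(V)`. -/
def lClass (𝒱 : ℤ → Submodule K W) {n : ℕ} (T : STree (Fin n)) (v : Fin n → W) : LBar 𝒱 :=
  DirectSum.lof K ℕ (LWeight 𝒱) n
    (LWeight.mk 𝒱 n (PiTensorProduct.tprod K v ⊗ₜ[K] Finsupp.single T (1 : K)))

/-- The homogeneous part of degree `m` of `Ē(W)`. -/
def eDegree (𝒲 : ℤ → Submodule K W) (m : ℤ) : Submodule K (EBar 𝒲) :=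
  Submodule.span K {x | ∃ (n : ℕ) (G : SGraph (Fin n)) (d : Fin n → ℤ) (w : Fin n → W),
    (∀ i, w i ∈ 𝒲 (d i)) ∧ ∑ i, d i = m ∧ x = eClass 𝒲 G w}

/-- The homogeneous part of degree `m` of `L̄(V)`. -/
def lDegree (𝒱 : ℤ → Submodule K W) (m : ℤ) : Submodule K (LBar 𝒱) :=
  Submodule.span K {x | ∃ (n : ℕ) (T : STree (Fin n)) (d : Fin n → ℤ) (v : Fin n → W),
    (∀ i, v i ∈ 𝒱 (d i)) ∧ ∑ i, d i = m ∧ x = lClass 𝒱 T v}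

/-- `Φ` is the configuration pairing between `Ē(W)` and `L̄(V)` which is induced by a pairing `B`
of `W` and `V`: for homogeneous `w₁, …, wₙ`,
`⟨[G ⊗ w₁ ⊗ ⋯ ⊗ wₙ], [T ⊗ v₁ ⊗ ⋯ ⊗ vₙ]⟩` is the sum over `σ` of
`± ⟨σ G, T⟩ ∏ i, ⟨w_{σ⁻¹ i}, vᵢ⟩` with the Koszul sign of reordering the `wᵢ`, and classes of
different weights pair to `0`. -/
def IsConfigurationPairing {V : Type*} [AddCommGroup V] [Module K V]
    (𝒲 : ℤ → Submodule K W) (𝒱 : ℤ → Submodule K V) (B : W →ₗ[K] V →ₗ[K] K)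
    (Φ : EBar 𝒲 →ₗ[K] LBar 𝒱 →ₗ[K] K) : Prop :=
  (∀ (n : ℕ) (G : SGraph (Fin n)) (T : STree (Fin n)) (d : Fin n → ℤ)
      (w : Fin n → W) (v : Fin n → V), (∀ i, w i ∈ 𝒲 (d i)) →
      Φ (eClass 𝒲 G w) (lClass 𝒱 T v) =
        ∑ σ : Equiv.Perm (Fin n),
          (koszulSign d σ : K) * (configPairing (G.relabel σ) T : K) *
            ∏ i, B (w (σ.symm i)) (v i)) ∧
  (∀ (m n : ℕ), m ≠ n → ∀ (G : SGraph (Fin m)) (T : STree (Fin n))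
      (w : Fin m → W) (v : Fin n → V), Φ (eClass 𝒲 G w) (lClass 𝒱 T v) = 0)

end Spaces

end LieGraph

end

noncomputable section

namespace LieGraph

/-! In each weight the heart of the matter is a duality between graphs modulo arrow-reversing and
Arnold and trees modulo anti-symmetry and Jacobi.

The pairing of graphs and trees respects the graph relations for a local reason. Reversing an edge
changes one sign. Of three leaves `a`, `b`, `c`, one branches off alone, so two of the edges `a →
b`, `b → c`, `c → a` have the same nadir and opposite signs (`separated_or`). A graph has as many
edges as a tree has internal vertices, so the Arnold term containing both of these edges pairs to
zero, and the other two terms cancel.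

The tree relations are reached indirectly. A long graph, that is, an oriented path through all
vertices, pairs with a tree to the coefficient of the corresponding word in the Lie polynomial of
the tree (`edgePairing_pathEdges`), and for Lie polynomials anti-symmetry and Jacobi are identities
of commutators. Modulo its relations every graph is a combination of long graphs beginning at a
fixed vertex (`single_mem_of_longGraph`), so the tree relations pair to zero with all graphs. The
left combs beginning at the same vertex span the trees (`single_mem_of_comb`) and are dual to these
long graphs (`wordCoeff_comb`). This gives `exists_dual_families`.

With tensors as coefficients, the kernel of the product pairing is generated by the graph or tree
relations (`mem_tensorRelations`). The configuration pairing of `x` and `y` is the product pairing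
of the norm `∑ σ, σ x` with `y`. If `x` is in its kernel, then the norm of `x` is a combination of
relations; it is also congruent to `n! x` in the coinvariants, so in characteristic zero `x` is
itself a combination of relations (`ker_symPairing`). Invariance of the product pairing moves the
norm to the other argument, which settles the other side.

Nondegeneracy passes to the direct sum over the weights and, as different degrees are orthogonal, to
the parts of each degree. Perfectness in the strong sense then follows by finite-dimensionality;
positive degrees bound the weight by the degree. -/

theorem leaves_of {S : Type*} (s : S) : leaves (.of s) = [s] := rfl

theorem leaves_mul {S : Type*} (l r : FreeMagma S) : leaves (l * r) = leaves l ++ leaves r := rfl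

theorem internalVertices_mul {S : Type*} (l r : FreeMagma S) : internalVertices (l * r) =
    insert [] ((internalVertices l).image (List.cons false) ∪
        (internalVertices r).image (List.cons true)) := rfl

theorem card_internalVertices {S : Type*} (t : FreeMagma S) :
    (internalVertices t).card + 1 = (leaves t).length := by
  induction t using FreeMagma.recOnMul with
  | ih1 s => rfl
  | ih2 l r hl hr =>
    rw [internalVertices_mul, leaves_mul, Finset.card_insert_of_notMem (by simp),
      Finset.card_union_of_disjoint, Finset.card_image_of_injective _ List.cons_injective,
      Finset.card_image_of_injective _ List.cons_injective, List.length_append, ← hl, ← hr]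
    · omega
    · simp [Finset.disjoint_left]

/-! ### Signs and nadirs: the graph relations for a fixed tree -/

section Pairing

variable {S : Type*} [DecidableEq S]

theorem nadir_mul (l r : FreeMagma S) (a b : S) : nadir (l * r) a b =
    if a ∈ leaves l ∧ b ∈ leaves l then false :: nadir l a b
      else if a ∈ leaves r ∧ b ∈ leaves r then true :: nadir r a b
      else [] := rfl

theorem nadir_comm (t : FreeMagma S) (a b : S) : nadir t a b = nadir t b a := by
  induction t using FreeMagma.recOnMul with
  | ih1 s => rfl
  | ih2 l r hl hr => simp only [nadir_mul, hl, hr, and_comm]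

/-- The sign of the pair `e` of leaves of `t`. -/
def pairSign (t : FreeMagma S) (e : S × S) : ℤ :=
  if (leaves t).idxOf e.1 < (leaves t).idxOf e.2 then 1 else -1

/-- Every internal vertex of `t` is the nadir of some pair in `E`. -/
def NadirOnto (E : Finset (S × S)) (t : FreeMagma S) : Prop :=
  ∀ v ∈ internalVertices t, ∃ e ∈ E, nadir t e.1 e.2 = v

open Classical in
/-- The configuration pairing of an arbitrary set of pairs with an arbitrary tree. -/
def edgePairing (E : Finset (S × S)) (t : FreeMagma S) : ℤ :=
  if NadirOnto E t then ∏ e ∈ E, pairSign t e else 0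

theorem configPairing_eq (G : SGraph S) (T : STree S) :
    configPairing G T = edgePairing G.edges T.tree := by
  unfold configPairing edgePairing NadirOnto pairSign edgeSign
  congr

/-- Pigeonhole: two edges with a common nadir leave too few edges to reach all internal vertices. -/
theorem not_nadirOnto_of_nadir_eq {E : Finset (S × S)} {t : FreeMagma S}
    (hcard : E.card ≤ (internalVertices t).card) {e e' : S × S} (he : e ∈ E) (he' : e' ∈ E)
    (hne : e ≠ e') (h : nadir t e.1 e.2 = nadir t e'.1 e'.2) : ¬NadirOnto E t := by
  intro hon
  have hsub : internalVertices t ⊆ (E.erase e).image fun e => nadir t e.1 e.2 := by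
    intro v hv
    obtain ⟨f, hf, rfl⟩ := hon v hv
    by_cases hfe : f = e
    · subst hfe
      exact Finset.mem_image.mpr ⟨e', Finset.mem_erase.mpr ⟨hne.symm, he'⟩, h.symm⟩
    · exact Finset.mem_image.mpr ⟨f, Finset.mem_erase.mpr ⟨hfe, hf⟩, rfl⟩
  have h1 := (Finset.card_le_card hsub).trans Finset.card_image_le
  rw [Finset.card_erase_of_mem he] at h1
  have := Finset.card_pos.mpr ⟨e, he⟩
  omega

/-- Surjectivity depends only on the nadirs of the edges, so this exchange of edges affects nothing
but one sign in the product. -/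
theorem edgePairing_insert_eq_neg {Q : Finset (S × S)} {t : FreeMagma S} {e e' : S × S}
    (he : e ∉ Q) (he' : e' ∉ Q) (h : nadir t e.1 e.2 = nadir t e'.1 e'.2)
    (hs : pairSign t e = -pairSign t e') :
    edgePairing (insert e Q) t = -edgePairing (insert e' Q) t := by
  have hiff : NadirOnto (insert e Q) t ↔ NadirOnto (insert e' Q) t := by
    simp [NadirOnto, h]
  unfold edgePairing
  rw [Finset.prod_insert he, Finset.prod_insert he', hs]
  by_cases hon : NadirOnto (insert e' Q) t
  · simp [hiff, hon]
  · simp [hiff, hon]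

theorem pairSign_swap {t : FreeMagma S} {a b : S} (ha : a ∈ leaves t) (hab : a ≠ b) :
    pairSign t (b, a) = -pairSign t (a, b) := by
  have : (leaves t).idxOf a ≠ (leaves t).idxOf b := fun h => hab ((List.idxOf_inj ha).mp h)
  unfold pairSign
  dsimp only
  split_ifs <;> omega

section Branches

variable {l r : FreeMagma S}

theorem pairSign_mul_left {a b : S} (ha : a ∈ leaves l) (hb : b ∈ leaves l) :
    pairSign (l * r) (a, b) = pairSign l (a, b) := by
  simp [pairSign, leaves_mul, List.idxOf_append_of_mem, ha, hb]

theorem pairSign_mul_right (hd : (leaves l).Disjoint (leaves r)) {a b : S} (ha : a ∈ leaves r)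
    (hb : b ∈ leaves r) : pairSign (l * r) (a, b) = pairSign r (a, b) := by
  simp only [pairSign, leaves_mul, List.idxOf_append_of_notMem fun h => hd h ha,
    List.idxOf_append_of_notMem fun h => hd h hb, add_lt_add_iff_left]

theorem pairSign_mul_left_right (hd : (leaves l).Disjoint (leaves r)) {a b : S}
    (ha : a ∈ leaves l) (hb : b ∈ leaves r) : pairSign (l * r) (a, b) = 1 := by
  have := List.idxOf_lt_length_iff.mpr ha
  simp only [pairSign, leaves_mul, List.idxOf_append_of_mem ha,
    List.idxOf_append_of_notMem fun h => hd h hb]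
  rw [if_pos (by omega)]

theorem pairSign_mul_right_left (hd : (leaves l).Disjoint (leaves r)) {a b : S}
    (ha : a ∈ leaves r) (hb : b ∈ leaves l) : pairSign (l * r) (a, b) = -1 := by
  have := List.idxOf_lt_length_iff.mpr hb
  simp only [pairSign, leaves_mul, List.idxOf_append_of_mem hb,
    List.idxOf_append_of_notMem fun h => hd h ha]
  rw [if_neg (by omega)]

end Branches

/-- The leaves `a` and `c` are in the same branch at the vertex where `b` branches off. -/
def Separated (t : FreeMagma S) (a b c : S) : Prop :=
  nadir t a b = nadir t b c ∧ pairSign t (a, b) = -pairSign t (b, c)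

/-- Descend until the three leaves no longer lie in one branch. There one of them is alone on its
side, and the cyclic edges into and out of it cross the vertex in opposite directions. The condition
`a ≠ b` prevents the descent from ending in a single leaf. -/
theorem separated_or {t : FreeMagma S} (ht : (leaves t).Nodup) {a b c : S} (ha : a ∈ leaves t)
    (hb : b ∈ leaves t) (hc : c ∈ leaves t) (hab : a ≠ b) :
    Separated t a b c ∨ Separated t b c a ∨ Separated t c a b := by
  induction t using FreeMagma.recOnMul with
  | ih1 s =>
    simp only [leaves_of, List.mem_singleton] at ha hb
    exact absurd (ha.trans hb.symm) hab
  | ih2 l r hl hr =>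
    rw [leaves_mul, List.nodup_append'] at ht
    obtain ⟨hnl, hnr, hd⟩ := ht
    simp only [leaves_mul, List.mem_append] at ha hb hc
    have nl : ∀ x ∈ leaves l, x ∉ leaves r := fun x hx h => hd hx h
    have nr : ∀ x ∈ leaves r, x ∉ leaves l := fun x hx h => hd h hx
    rcases ha with ha | ha <;> rcases hb with hb | hb <;> rcases hc with hc | hc
    · simpa [Separated, nadir_mul, ha, hb, hc, pairSign_mul_left] using hl hnl ha hb hc
    · right; left
      simp [Separated, nadir_mul, ha, hb, hc, pairSign_mul_left_right hd,
        pairSign_mul_right_left hd, nl, nr]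
    · left
      simp [Separated, nadir_mul, ha, hb, hc, pairSign_mul_left_right hd,
        pairSign_mul_right_left hd, nl, nr]
    · right; right
      simp [Separated, nadir_mul, ha, hb, hc, pairSign_mul_left_right hd,
        pairSign_mul_right_left hd, nl, nr]
    · right; right
      simp [Separated, nadir_mul, ha, hb, hc, pairSign_mul_left_right hd,
        pairSign_mul_right_left hd, nl, nr]
    · left
      simp [Separated, nadir_mul, ha, hb, hc, pairSign_mul_left_right hd,
        pairSign_mul_right_left hd, nl, nr]
    · right; left
      simp [Separated, nadir_mul, ha, hb, hc, pairSign_mul_left_right hd,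
        pairSign_mul_right_left hd, nl, nr]
    · simpa [Separated, nadir_mul, ha, hb, hc, pairSign_mul_right hd, nr] using hr hnr ha hb hc

/-- The first term has two edges with the same nadir and vanishes by pigeonhole. The other two terms
differ by the exchange of `(b, c)` for `(a, b)`, which changes the sign. -/
theorem edgePairing_arnold_of_separated {R : Finset (S × S)} {t : FreeMagma S} {a b c : S}
    (hab : a ≠ b) (h₁ : (a, b) ∉ R) (h₂ : (b, c) ∉ R) (hbc : b ≠ c)
    (hcard : (insert (a, b) (insert (b, c) R)).card ≤ (internalVertices t).card)
    (h : Separated t a b c) :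
    edgePairing (insert (a, b) (insert (b, c) R)) t +
      edgePairing (insert (b, c) (insert (c, a) R)) t +
      edgePairing (insert (c, a) (insert (a, b) R)) t = 0 := by
  have e1 : edgePairing (insert (a, b) (insert (b, c) R)) t = 0 :=
    if_neg (not_nadirOnto_of_nadir_eq hcard (e := (a, b)) (e' := (b, c)) (by simp) (by simp)
      (by simp [hab]) h.1)
  rw [e1, Finset.insert_comm (c, a) (a, b), edgePairing_insert_eq_neg (e := (a, b)) (e' := (b, c))
    _ _ h.1 h.2]
  · simp
  · have : ¬(a = c ∧ b = a) := fun h => hab h.2.symm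
    simp [h₁, this]
  · have : ¬(b = c ∧ c = a) := fun h => hbc h.1
    simp [h₂, this]

theorem edgePairing_arnold {R : Finset (S × S)} {t : FreeMagma S} (ht : (leaves t).Nodup)
    {a b c : S} (ha : a ∈ leaves t) (hb : b ∈ leaves t) (hc : c ∈ leaves t)
    (hab : a ≠ b) (hbc : b ≠ c) (hca : c ≠ a)
    (h₁ : (a, b) ∉ R) (h₂ : (b, c) ∉ R) (h₃ : (c, a) ∉ R)
    (hcard : R.card + 2 ≤ (internalVertices t).card) :
    edgePairing (insert (a, b) (insert (b, c) R)) t +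
      edgePairing (insert (b, c) (insert (c, a) R)) t +
      edgePairing (insert (c, a) (insert (a, b) R)) t = 0 := by
  have hcard' : ∀ e f : S × S, (insert e (insert f R)).card ≤ (internalVertices t).card :=
    fun e f => (Finset.card_insert_le _ _).trans
      ((Nat.add_le_add_right (Finset.card_insert_le _ _) 1).trans hcard)
  rcases separated_or ht ha hb hc hab with h | h | h
  · exact edgePairing_arnold_of_separated hab h₁ h₂ hbc (hcard' _ _) h
  · linarith [edgePairing_arnold_of_separated hbc h₂ h₃ hca (hcard' _ _) h]
  · linarith [edgePairing_arnold_of_separated hca h₃ h₁ hab (hcard' _ _) h]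

end Pairing

/-! ### Counting edges and internal vertices; the graph relations -/

section Card

variable {S : Type*}

theorem card_edgeSet_fromRel {E : Finset (S × S)} (hE : ∀ a b, (a, b) ∈ E → (b, a) ∉ E) :
    Nat.card (SimpleGraph.fromRel fun a b => (a, b) ∈ E).edgeSet = E.card := by
  classical
  have h : (SimpleGraph.fromRel fun a b => (a, b) ∈ E).edgeSet =
      ↑(E.image fun e => s(e.1, e.2)) := by
    ext e
    induction e with | _ a b => ?_
    simp only [SimpleGraph.mem_edgeSet, SimpleGraph.fromRel_adj, Finset.coe_image, Set.mem_image,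
      Finset.mem_coe, Prod.exists, Sym2.eq_iff]
    constructor
    · rintro ⟨-, h | h⟩
      exacts [⟨a, b, h, .inl ⟨rfl, rfl⟩⟩, ⟨b, a, h, .inr ⟨rfl, rfl⟩⟩]
    · rintro ⟨x, y, h, ⟨rfl, rfl⟩ | ⟨rfl, rfl⟩⟩
      · exact ⟨fun e => hE _ _ h (by rw [← e] at h ⊢; exact h), .inl h⟩
      · exact ⟨fun e => hE _ _ h (by rw [← e] at h ⊢; exact h), .inr h⟩
  rw [h, Nat.card_coe_set_eq, Set.ncard_coe_finset, Finset.card_image_of_injOn]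
  rintro ⟨a, b⟩ hab ⟨c, d⟩ hcd h
  simp only [Sym2.eq_iff] at h
  rcases h with ⟨rfl, rfl⟩ | ⟨rfl, rfl⟩
  · rfl
  · exact absurd hcd (hE _ _ hab)

namespace SGraph

theorem ne_of_mem (G : SGraph S) {a b : S} (h : (a, b) ∈ G.edges) : a ≠ b := by
  rintro rfl
  exact G.asymm _ _ h h

theorem card_edges [Finite S] (G : SGraph S) : G.edges.card + 1 = Nat.card S := by
  rw [← card_edgeSet_fromRel G.asymm]
  exact (SimpleGraph.isTree_iff_connected_and_card.mp G.isTree).2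

end SGraph

theorem STree.card_internalVertices (T : STree S) :
    (internalVertices T.tree).card + 1 = Nat.card S := by
  classical
  have : Fintype S := ⟨(leaves T.tree).toFinset, by simp [T.complete]⟩
  rw [LieGraph.card_internalVertices, Nat.card_eq_fintype_card,
    ← List.toFinset_card_of_nodup T.nodup]
  congr 1
  ext s
  simp [T.complete]

variable [DecidableEq S]

theorem configPairing_arrowReversed {G H : SGraph S} (h : G.ArrowReversed H) (T : STree S) :
    configPairing G T + configPairing H T = 0 := by
  obtain ⟨a, b, R, h₁, h₂, hG, hH⟩ := h
  have hR : R ⊆ G.edges := by rw [hG]; exact Set.subset_insert _ _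
  obtain ⟨R, rfl⟩ := (G.edges.finite_toSet.subset hR).exists_finset_coe
  rw [← Finset.coe_insert, Finset.coe_inj] at hG hH
  have hab : a ≠ b := G.ne_of_mem (hG ▸ Finset.mem_insert_self _ _)
  rw [configPairing_eq, configPairing_eq, hG, hH,
    edgePairing_insert_eq_neg (Q := R) (e := (a, b)) (e' := (b, a)) (mod_cast h₁) (mod_cast h₂)
      (nadir_comm _ _ _) (pairSign_swap (T.complete _) hab.symm)]
  exact neg_add_cancel _

theorem configPairing_arnold [Finite S] {G₁ G₂ G₃ : SGraph S} (h : SGraph.Arnold G₁ G₂ G₃)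
    (T : STree S) :
    configPairing G₁ T + configPairing G₂ T + configPairing G₃ T = 0 := by
  obtain ⟨a, b, c, R, hR, h₁, h₂, h₃⟩ := h
  have hsub : R ⊆ G₁.edges := by rw [h₁]; exact Set.subset_union_right
  obtain ⟨R, rfl⟩ := (G₁.edges.finite_toSet.subset hsub).exists_finset_coe
  simp only [Set.insert_union, Set.singleton_union, ← Finset.coe_insert, Finset.coe_inj]
    at h₁ h₂ h₃
  have hab : a ≠ b := G₁.ne_of_mem (by simp [h₁])
  have hbc : b ≠ c := G₁.ne_of_mem (by simp [h₁])
  have hca : c ≠ a := G₂.ne_of_mem (by simp [h₂])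
  have r₁ : (a, b) ∉ R := mod_cast hR _ (by simp)
  have r₂ : (b, c) ∉ R := mod_cast hR _ (by simp)
  have r₃ : (c, a) ∉ R := mod_cast hR _ (by simp)
  -- Edges of a graph and internal vertices of a tree both number one less than the labels; this
  -- supplies the bound needed for the pigeonhole argument.
  have hc := G₁.card_edges
  rw [← T.card_internalVertices, h₁, Finset.card_insert_of_notMem (by simp [r₁, hab]),
    Finset.card_insert_of_notMem r₂] at hc
  rw [configPairing_eq, configPairing_eq, configPairing_eq, h₁, h₂, h₃]
  exact edgePairing_arnold T.nodup (T.complete _) (T.complete _) (T.complete _) hab hbc hca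
    r₁ r₂ r₃ (by omega)

end Card

/-! ### Relabelling and invariance of the pairing -/

section Relabel

variable {S : Type*}

theorem SGraph.relabel_one (G : SGraph S) : G.relabel 1 = G := by
  ext e
  simp only [SGraph.relabel, Finset.mem_map_equiv]
  rfl

theorem SGraph.relabel_mul (σ τ : Equiv.Perm S) (G : SGraph S) :
    G.relabel (σ * τ) = (G.relabel τ).relabel σ := by
  ext e
  simp only [SGraph.relabel, Finset.mem_map_equiv]
  rfl

theorem STree.relabel_one (T : STree S) : T.relabel 1 = T := by
  ext1
  change FreeMagma.map id T.tree = T.tree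
  induction T.tree using FreeMagma.recOnMul with
  | ih1 s => rfl
  | ih2 l r hl hr => rw [map_mul, hl, hr]

theorem STree.relabel_mul (σ τ : Equiv.Perm S) (T : STree S) :
    T.relabel (σ * τ) = (T.relabel τ).relabel σ := by
  ext1
  change FreeMagma.map (σ ∘ τ) T.tree = FreeMagma.map σ (FreeMagma.map τ T.tree)
  induction T.tree using FreeMagma.recOnMul with
  | ih1 s => rfl
  | ih2 l r hl hr => rw [map_mul, map_mul, map_mul, hl, hr]

theorem internalVertices_map (σ : Equiv.Perm S) (t : FreeMagma S) :
    internalVertices (FreeMagma.map σ t) = internalVertices t := by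
  induction t using FreeMagma.recOnMul with
  | ih1 s => rfl
  | ih2 l r hl hr => rw [map_mul, internalVertices_mul, hl, hr, internalVertices_mul]

variable [DecidableEq S]

theorem nadir_map (σ : Equiv.Perm S) (t : FreeMagma S) (a b : S) :
    nadir (FreeMagma.map σ t) (σ a) (σ b) = nadir t a b := by
  induction t using FreeMagma.recOnMul with
  | ih1 s => rfl
  | ih2 l r hl hr =>
    simp only [map_mul, nadir_mul, leaves_map, hl, hr, List.mem_map_of_injective σ.injective]

theorem idxOf_map (σ : Equiv.Perm S) (L : List S) (a : S) :
    (L.map σ).idxOf (σ a) = L.idxOf a := by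
  induction L with
  | nil => rfl
  | cons b L ih =>
    have : (σ b == σ a) = (b == a) := Bool.eq_iff_iff.mpr (by simp)
    simp only [List.map_cons, List.idxOf_cons, ih, this]

theorem configPairing_relabel (σ : Equiv.Perm S) (G : SGraph S) (T : STree S) :
    configPairing (G.relabel σ) (T.relabel σ) = configPairing G T := by
  have hE : (G.relabel σ).edges = G.edges.map (σ.prodCongr σ).toEmbedding := rfl
  have hT : (T.relabel σ).tree = FreeMagma.map σ T.tree := rfl
  have hn : ∀ e : S × S, nadir (FreeMagma.map σ T.tree) (σ.prodCongr σ e).1 (σ.prodCongr σ e).2 =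
      nadir T.tree e.1 e.2 := fun e => nadir_map σ _ _ _
  have hs : ∀ e : S × S, pairSign (FreeMagma.map σ T.tree) (σ.prodCongr σ e) =
      pairSign T.tree e := by
    intro e
    simp [pairSign, leaves_map, idxOf_map]
  have h : NadirOnto (G.relabel σ).edges (T.relabel σ).tree ↔ NadirOnto G.edges T.tree := by
    simp only [NadirOnto, hE, hT, internalVertices_map, Finset.mem_map,
      Equiv.coe_toEmbedding, exists_exists_and_eq_and, hn]
  rw [configPairing_eq, configPairing_eq]
  unfold edgePairing
  by_cases hon : NadirOnto G.edges T.tree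
  · rw [if_pos hon, if_pos (h.mpr hon)]
    simp only [hE, hT, Finset.prod_map, Equiv.coe_toEmbedding, hs]
  · rw [if_neg hon, if_neg (h.not.mpr hon)]

end Relabel

/-! ### Lie polynomials of trees and their word coefficients -/

section WordAlgebra

variable {S : Type*}

/-- The Lie polynomial of a tree, in the free associative ring on the labels. -/
def bracketPoly : FreeMagma S → MonoidAlgebra ℤ (FreeMonoid S)
  | .of s => MonoidAlgebra.single (FreeMonoid.of s) 1
  | .mul l r => bracketPoly l * bracketPoly r - bracketPoly r * bracketPoly l

theorem bracketPoly_mul (l r : FreeMagma S) : bracketPoly (l * r) =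
    bracketPoly l * bracketPoly r - bracketPoly r * bracketPoly l := rfl

/-- The coefficient of a word in the Lie polynomial of a tree. -/
def wordCoeff (t : FreeMagma S) (u : List S) : ℤ := (bracketPoly t).coeff (FreeMonoid.ofList u)

theorem exists_of_coeff_mul_ne_zero {f g : MonoidAlgebra ℤ (FreeMonoid S)} {u : List S}
    (h : (f * g).coeff (FreeMonoid.ofList u) ≠ 0) :
    ∃ v w, u = v ++ w ∧ f.coeff (FreeMonoid.ofList v) ≠ 0 ∧ g.coeff (FreeMonoid.ofList w) ≠ 0 := by
  classical
  rw [MonoidAlgebra.coeff_mul] at h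
  obtain ⟨v, hv, h⟩ := Finset.exists_ne_zero_of_sum_ne_zero h
  obtain ⟨w, hw, h⟩ := Finset.exists_ne_zero_of_sum_ne_zero h
  have : v * w = FreeMonoid.ofList u := by
    by_contra hne
    exact h (if_neg hne)
  exact ⟨v.toList, w.toList, this.symm, Finsupp.mem_support_iff.mp hv,
    Finsupp.mem_support_iff.mp hw⟩

/-- All words of `f` have the length of `v`, so the word `v ++ w` can be cut in only one place. -/
theorem coeff_mul_append {f g : MonoidAlgebra ℤ (FreeMonoid S)} {v w : List S}
    (hf : ∀ x : List S, f.coeff (FreeMonoid.ofList x) ≠ 0 → x.length = v.length) :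
    (f * g).coeff (FreeMonoid.ofList (v ++ w)) =
      f.coeff (FreeMonoid.ofList v) * g.coeff (FreeMonoid.ofList w) := by
  classical
  have key : ∀ x y : FreeMonoid S, f.coeff x ≠ 0 → x * y = FreeMonoid.ofList (v ++ w) →
      x = FreeMonoid.ofList v ∧ y = FreeMonoid.ofList w := by
    intro x y hx h
    exact List.append_inj h (hf x.toList hx)
  rw [MonoidAlgebra.coeff_mul, Finsupp.sum, Finset.sum_eq_single (FreeMonoid.ofList v)]
  · rw [Finsupp.sum, Finset.sum_eq_single (FreeMonoid.ofList w)]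
    · exact if_pos rfl
    · intro y hy hne
      refine if_neg fun h => hne ?_
      exact List.append_cancel_left h
    · intro h
      rw [Finsupp.notMem_support_iff.mp h]
      simp
  · intro x hx hne
    refine Finset.sum_eq_zero fun y hy => if_neg fun h => hne ?_
    exact (key x y (Finsupp.mem_support_iff.mp hx) h).1
  · intro h
    rw [Finsupp.notMem_support_iff.mp h]
    simp

theorem perm_of_wordCoeff_ne_zero {t : FreeMagma S} {u : List S} (h : wordCoeff t u ≠ 0) :
    u.Perm (leaves t) := by
  induction t using FreeMagma.recOnMul generalizing u with
  | ih1 s =>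
    classical
    have : FreeMonoid.of s = FreeMonoid.ofList u := by
      by_contra hne
      exact h (Finsupp.single_eq_of_ne' hne)
    have : [s] = u := this
    rw [← this, leaves_of]
  | ih2 l r hl hr =>
    have h' : (bracketPoly l * bracketPoly r).coeff (FreeMonoid.ofList u) -
      (bracketPoly r * bracketPoly l).coeff (FreeMonoid.ofList u) ≠ 0 := h
    by_cases h0 : (bracketPoly l * bracketPoly r).coeff (FreeMonoid.ofList u) = 0
    · rw [h0, zero_sub, neg_ne_zero] at h'
      obtain ⟨v, w, rfl, hv, hw⟩ := exists_of_coeff_mul_ne_zero h'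
      exact List.perm_append_comm.trans ((hl hw).append (hr hv))
    · obtain ⟨v, w, rfl, hv, hw⟩ := exists_of_coeff_mul_ne_zero h0
      exact (hl hv).append (hr hw)

theorem coeff_bracketPoly_mul_append {t : FreeMagma S} {g : MonoidAlgebra ℤ (FreeMonoid S)}
    {v w : List S} (hv : v.length = (leaves t).length) :
    (bracketPoly t * g).coeff (FreeMonoid.ofList (v ++ w)) =
      wordCoeff t v * g.coeff (FreeMonoid.ofList w) :=
  coeff_mul_append fun _ hx => (perm_of_wordCoeff_ne_zero hx).length_eq.trans hv.symm

theorem leaves_ne_nil (t : FreeMagma S) : leaves t ≠ [] := by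
  intro h
  have := card_internalVertices t
  simp [h] at this

/-- Words of this product begin with a leaf of `l`, whereas `v` begins with a leaf of `r`. -/
theorem coeff_bracketPoly_mul_eq_zero {l r : FreeMagma S}
    (hd : (leaves l).Disjoint (leaves r)) {v w : List S} (hv : v.Perm (leaves r)) :
    (bracketPoly l * bracketPoly r).coeff (FreeMonoid.ofList (v ++ w)) = 0 := by
  by_contra h
  obtain ⟨x, y, hxy, hx, -⟩ := exists_of_coeff_mul_ne_zero h
  have hx := perm_of_wordCoeff_ne_zero hx
  obtain _ | ⟨a, x⟩ := x
  · exact leaves_ne_nil l hx.nil_eq.symm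
  obtain _ | ⟨b, v⟩ := v
  · exact leaves_ne_nil r hv.nil_eq.symm
  obtain ⟨rfl, -⟩ := List.cons.inj hxy
  exact hd (hx.subset List.mem_cons_self) (hv.subset List.mem_cons_self)

/-- Only one term of the commutator has words beginning in `l`. Together with `wordCoeff_mul_right`
this is the recursion that the configuration pairing of long graphs will be shown to share. -/
theorem wordCoeff_mul_left {l r : FreeMagma S} (hd : (leaves l).Disjoint (leaves r))
    {v w : List S} (hv : v.Perm (leaves l)) :
    wordCoeff (l * r) (v ++ w) = wordCoeff l v * wordCoeff r w := by
  have h : wordCoeff (l * r) (v ++ w) =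
    (bracketPoly l * bracketPoly r).coeff (FreeMonoid.ofList (v ++ w)) -
      (bracketPoly r * bracketPoly l).coeff (FreeMonoid.ofList (v ++ w)) := rfl
  rw [h, coeff_bracketPoly_mul_append hv.length_eq, coeff_bracketPoly_mul_eq_zero hd.symm hv,
    sub_zero]
  rfl

theorem wordCoeff_mul_right {l r : FreeMagma S} (hd : (leaves l).Disjoint (leaves r))
    {v w : List S} (hv : v.Perm (leaves r)) :
    wordCoeff (l * r) (v ++ w) = -(wordCoeff r v * wordCoeff l w) := by
  have h : wordCoeff (l * r) (v ++ w) =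
    (bracketPoly l * bracketPoly r).coeff (FreeMonoid.ofList (v ++ w)) -
      (bracketPoly r * bracketPoly l).coeff (FreeMonoid.ofList (v ++ w)) := rfl
  rw [h, coeff_bracketPoly_mul_append hv.length_eq, coeff_bracketPoly_mul_eq_zero hd hv,
    zero_sub]
  rfl

theorem split_of_wordCoeff_ne_zero {l r : FreeMagma S} {u : List S}
    (h : wordCoeff (l * r) u ≠ 0) : ∃ v w, u = v ++ w ∧
      (v.Perm (leaves l) ∧ w.Perm (leaves r) ∨ v.Perm (leaves r) ∧ w.Perm (leaves l)) := by
  have h' : (bracketPoly l * bracketPoly r).coeff (FreeMonoid.ofList u) -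
    (bracketPoly r * bracketPoly l).coeff (FreeMonoid.ofList u) ≠ 0 := h
  by_cases h0 : (bracketPoly l * bracketPoly r).coeff (FreeMonoid.ofList u) = 0
  · rw [h0, zero_sub, neg_ne_zero] at h'
    obtain ⟨v, w, rfl, hv, hw⟩ := exists_of_coeff_mul_ne_zero h'
    exact ⟨v, w, rfl, .inr ⟨perm_of_wordCoeff_ne_zero hv, perm_of_wordCoeff_ne_zero hw⟩⟩
  · obtain ⟨v, w, rfl, hv, hw⟩ := exists_of_coeff_mul_ne_zero h0
    exact ⟨v, w, rfl, .inl ⟨perm_of_wordCoeff_ne_zero hv, perm_of_wordCoeff_ne_zero hw⟩⟩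

theorem bracketPoly_branchSwap {t t' : FreeMagma S} (h : BranchSwap t t') :
    bracketPoly t + bracketPoly t' = 0 := by
  induction h with
  | root t₁ t₂ => simp [bracketPoly_mul]
  | left r h ih => simp [bracketPoly_mul, eq_neg_of_add_eq_zero_left ih]
  | right l h ih => simp [bracketPoly_mul, eq_neg_of_add_eq_zero_left ih]

theorem bracketPoly_jacobi {t t' t'' : FreeMagma S} (h : Jacobi t t' t'') :
    bracketPoly t + bracketPoly t' + bracketPoly t'' = 0 := by
  induction h with
  | root t₁ t₂ t₃ =>
    simp only [bracketPoly_mul]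
    noncomm_ring
  | left r h ih =>
    simp only [bracketPoly_mul, eq_neg_of_add_eq_zero_right ih]
    noncomm_ring
  | right l h ih =>
    simp only [bracketPoly_mul, eq_neg_of_add_eq_zero_right ih]
    noncomm_ring

/-- The left comb `(⋯((t a₁) a₂)⋯) aₖ`. -/
def comb (t : FreeMagma S) (L : List S) : FreeMagma S := L.foldl (fun t a => t * .of a) t

theorem comb_append (t : FreeMagma S) (L L' : List S) :
    comb t (L ++ L') = comb (comb t L) L' := List.foldl_append

theorem leaves_comb (t : FreeMagma S) (L : List S) : leaves (comb t L) = leaves t ++ L := by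
  induction L generalizing t with
  | nil => simp [comb]
  | cons a L ih => 
    have := ih (t * .of a)
    rwa [leaves_mul, leaves_of, List.append_assoc] at this

/-- Expanding the iterated commutator, a term in which some letter is multiplied from the left does
not begin with `s`. The only word beginning with `s` is therefore `s :: L'`, with coefficient one.
-/
theorem wordCoeff_comb [DecidableEq S] {s : S} {L L' : List S} (hL' : s ∉ L') :
    wordCoeff (comb (.of s) L') (s :: L) = if L = L' then 1 else 0 := by
  induction L' using List.reverseRecOn generalizing L with
  | nil =>
    have : wordCoeff (.of s) (s :: L) = if [s] = s :: L then 1 else 0 :=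
      @Finsupp.single_apply _ _ _ _ _ _ (instDecidableEqList [s] (s :: L))
    simpa [comb, eq_comm] using this
  | append_singleton L' a ih =>
    simp only [List.mem_append, List.mem_singleton, not_or] at hL'
    obtain ⟨hs, hsa⟩ := hL'
    have e : wordCoeff (comb (.of s) (L' ++ [a])) (s :: L) =
        (bracketPoly (comb (.of s) L') * MonoidAlgebra.single (FreeMonoid.of a) 1).coeff
          (FreeMonoid.ofList (s :: L)) -
        (MonoidAlgebra.single (FreeMonoid.of a) 1 * bracketPoly (comb (.of s) L')).coeff
          (FreeMonoid.ofList (s :: L)) := by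
      rw [comb_append]
      rfl
    rw [e, MonoidAlgebra.coeff_single_mul_of_forall_mul_ne, sub_zero]
    · by_cases hL : ∃ M, L = M ++ [a]
      · obtain ⟨M, rfl⟩ := hL
        rw [MonoidAlgebra.coeff_mul_single_eq_coeff_mul (FreeMonoid.ofList (s :: M)), mul_one]
        · exact (ih (L := M) hs).trans (by simp)
        · intro m _
          exact mul_left_inj (a := FreeMonoid.of a) (b := m) (c := FreeMonoid.ofList (s :: M))
      · rw [MonoidAlgebra.coeff_mul_single_of_forall_mul_ne, if_neg fun h => hL ⟨_, h⟩]
        intro d hd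
        have hd : d.toList ++ [a] = s :: L := hd
        rcases hd' : d.toList with _ | ⟨b, d'⟩
        · rw [hd'] at hd
          exact hsa (List.cons.inj hd).1.symm
        · rw [hd'] at hd
          exact hL ⟨d', (List.cons.inj hd).2.symm⟩
    · intro d hd
      exact hsa (List.cons.inj (show a :: d.toList = s :: L from hd)).1.symm

end WordAlgebra

theorem perm_of_append_perm {S : Type*} {L R v w : List S} (hd : L.Disjoint R) (hL : L.Nodup)
    (h : (v ++ w).Perm (L ++ R)) (hvw : (v ++ w).Nodup) (hv : ∀ x ∈ v, x ∈ L)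
    (hw : ∀ x ∈ w, x ∈ R) : v.Perm L := by
  refine (List.perm_ext_iff_of_nodup (List.nodup_append'.mp hvw).1 hL).mpr fun x =>
    ⟨hv x, fun hx => ?_⟩
  rcases List.mem_append.mp (h.symm.subset (List.mem_append_left _ hx)) with h | h
  · exact h
  · exact absurd (hw x h) fun h' => hd hx h'

/-! ### Pairing long graphs with trees -/

section PathEdges

variable {S : Type*} [DecidableEq S]

/-- The pairs of consecutive entries of a list. -/
def pathEdges : List S → Finset (S × S)
  | a :: b :: u => insert (a, b) (pathEdges (b :: u))
  | _ => ∅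

theorem pathEdges_append (u v : List S) (a b : S) :
    pathEdges (u ++ a :: b :: v) = insert (a, b) (pathEdges (u ++ [a]) ∪ pathEdges (b :: v)) := by
  induction u with
  | nil => simp [pathEdges]
  | cons c u ih =>
    rcases u with _ | ⟨d, u⟩
    · simp only [List.cons_append, List.nil_append, pathEdges] at ih ⊢
      ext e
      simp
      tauto
    · simp only [List.cons_append, pathEdges] at ih ⊢
      rw [ih]
      ext e
      simp
      tauto

theorem mem_of_mem_pathEdges {u : List S} {e : S × S} (h : e ∈ pathEdges u) :
    e.1 ∈ u ∧ e.2 ∈ u := by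
  induction u with
  | nil => simp [pathEdges] at h
  | cons c u ih =>
    rcases u with _ | ⟨d, u⟩
    · simp [pathEdges] at h
    · simp only [pathEdges, Finset.mem_insert] at h
      rcases h with rfl | h
      · simp
      · exact ⟨List.mem_cons_of_mem _ (ih h).1, List.mem_cons_of_mem _ (ih h).2⟩

theorem exists_split_of_mem_pathEdges {u : List S} {a b : S} (h : (a, b) ∈ pathEdges u) :
    ∃ v w, u = v ++ a :: b :: w := by
  induction u with
  | nil => simp [pathEdges] at h
  | cons c u ih =>
    rcases u with _ | ⟨d, u⟩
    · simp [pathEdges] at h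
    · simp only [pathEdges, Finset.mem_insert] at h
      rcases h with h | h
      · obtain ⟨rfl, rfl⟩ := Prod.mk.inj h
        exact ⟨[], u, rfl⟩
      · obtain ⟨v, w, hvw⟩ := ih h
        exact ⟨c :: v, w, by rw [hvw]; rfl⟩

theorem card_pathEdges {u : List S} (hu : u.Nodup) : (pathEdges u).card = u.length - 1 := by
  induction u with
  | nil => rfl
  | cons c u ih =>
    rcases u with _ | ⟨d, u⟩
    · rfl
    · rw [pathEdges, Finset.card_insert_of_notMem, ih hu.of_cons]
      · rfl
      · intro h
        exact (List.nodup_cons.mp hu).1 (mem_of_mem_pathEdges h).1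

/-- A property unchanged along every edge is constant on the path. It is applied to membership in a
branch and to reachability. -/
theorem forall_mem_of_pathEdges {P : S → Prop} {u : List S}
    (h : ∀ e ∈ pathEdges u, P e.1 ↔ P e.2) {a : S} (ha : a ∈ u) (hP : P a) : ∀ b ∈ u, P b := by
  have key : ∀ (c : S) (u : List S), (∀ e ∈ pathEdges (c :: u), P e.1 ↔ P e.2) →
      ∀ b ∈ u, P b ↔ P c := by
    intro c u
    induction u generalizing c with
    | nil => simp
    | cons d u ih =>
      intro h b hb
      have h1 : P c ↔ P d := h (c, d) (by simp [pathEdges])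
      rcases List.mem_cons.mp hb with rfl | hb
      · exact h1.symm
      · exact (ih d (fun e he => h e (by simp [pathEdges, he])) b hb).trans h1.symm
  rcases u with _ | ⟨c, u⟩
  · simp at ha
  · have hc : P c := by
      rcases List.mem_cons.mp ha with rfl | ha
      · exact hP
      · exact (key c u h a ha).mp hP
    intro b hb
    rcases List.mem_cons.mp hb with rfl | hb
    · exact hc
    · exact (key c u h b hb).mpr hc

/-- Edges inside a branch keep their sign and have their nadir in that branch, and `e` is the only
edge with nadir at the root. Hence surjectivity can be tested in the branches separately and the
signs multiply. -/
theorem edgePairing_join {l r : FreeMagma S} (hd : (leaves l).Disjoint (leaves r))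
    {E F : Finset (S × S)} (hE : ∀ e ∈ E, e.1 ∈ leaves l ∧ e.2 ∈ leaves l)
    (hF : ∀ e ∈ F, e.1 ∈ leaves r ∧ e.2 ∈ leaves r) {e : S × S}
    (he : e.1 ∈ leaves l ∧ e.2 ∈ leaves r ∨ e.1 ∈ leaves r ∧ e.2 ∈ leaves l) :
    edgePairing (insert e (E ∪ F)) (l * r) =
      pairSign (l * r) e * (edgePairing E l * edgePairing F r) := by
  have nl : ∀ x ∈ leaves l, x ∉ leaves r := fun x hx h => hd hx h
  have nr : ∀ x ∈ leaves r, x ∉ leaves l := fun x hx h => hd h hx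
  have nE : ∀ f ∈ E, nadir (l * r) f.1 f.2 = false :: nadir l f.1 f.2 := fun f hf => by
    simp [nadir_mul, hE f hf]
  have nF : ∀ f ∈ F, nadir (l * r) f.1 f.2 = true :: nadir r f.1 f.2 := fun f hf => by
    simp [nadir_mul, hF f hf, nr _ (hF f hf).1]
  have ne : nadir (l * r) e.1 e.2 = [] := by
    rcases he with ⟨h, h'⟩ | ⟨h, h'⟩ <;> simp [nadir_mul, nl, nr, h, h']
  have heE : e ∉ E := fun h => by
    have := (nE e h).symm.trans ne
    simp at this
  have heF : e ∉ F := fun h => by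
    have := (nF e h).symm.trans ne
    simp at this
  have hEF : Disjoint E F := Finset.disjoint_left.mpr fun f hf hf' => hd (hE f hf).1 (hF f hf').1
  have hon : NadirOnto (insert e (E ∪ F)) (l * r) ↔ NadirOnto E l ∧ NadirOnto F r := by
    constructor
    · intro h
      constructor
      · intro v hv
        obtain ⟨f, hf, hfv⟩ := h (false :: v) (by simp [internalVertices_mul, hv])
        simp only [Finset.mem_insert, Finset.mem_union] at hf
        rcases hf with rfl | hf | hf
        · simp [ne] at hfv
        · exact ⟨f, hf, (List.cons.inj ((nE f hf).symm.trans hfv)).2⟩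
        · simp [nF f hf] at hfv
      · intro v hv
        obtain ⟨f, hf, hfv⟩ := h (true :: v) (by simp [internalVertices_mul, hv])
        simp only [Finset.mem_insert, Finset.mem_union] at hf
        rcases hf with rfl | hf | hf
        · simp [ne] at hfv
        · simp [nE f hf] at hfv
        · exact ⟨f, hf, (List.cons.inj ((nF f hf).symm.trans hfv)).2⟩
    · rintro ⟨h₁, h₂⟩ v hv
      simp only [internalVertices_mul, Finset.mem_insert, Finset.mem_union, Finset.mem_image] at hv
      rcases hv with rfl | ⟨v, hv, rfl⟩ | ⟨v, hv, rfl⟩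
      · exact ⟨e, by simp, ne⟩
      · obtain ⟨f, hf, rfl⟩ := h₁ v hv
        exact ⟨f, by simp [hf], nE f hf⟩
      · obtain ⟨f, hf, rfl⟩ := h₂ v hv
        exact ⟨f, by simp [hf], nF f hf⟩
  have pE : ∏ f ∈ E, pairSign (l * r) f = ∏ f ∈ E, pairSign l f :=
    Finset.prod_congr rfl fun f hf => pairSign_mul_left (hE f hf).1 (hE f hf).2
  have pF : ∏ f ∈ F, pairSign (l * r) f = ∏ f ∈ F, pairSign r f :=
    Finset.prod_congr rfl fun f hf => pairSign_mul_right hd (hF f hf).1 (hF f hf).2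
  unfold edgePairing
  rw [Finset.prod_insert (by simp [heE, heF]), Finset.prod_union hEF, pE, pF]
  by_cases h₁ : NadirOnto E l <;> by_cases h₂ : NadirOnto F r <;> simp [hon, h₁, h₂]

/-- The only edge between the branches runs from the last letter of `v` to the first letter of `w`,
from left to right. In the primed version it runs from right to left, whence the sign. -/
theorem edgePairing_pathEdges_append {l r : FreeMagma S} (hd : (leaves l).Disjoint (leaves r))
    {v w : List S} (h : v.Perm (leaves l) ∧ w.Perm (leaves r)) :
    edgePairing (pathEdges (v ++ w)) (l * r) =
      edgePairing (pathEdges v) l * edgePairing (pathEdges w) r := by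
  rcases v.eq_nil_or_concat with rfl | ⟨v, a, rfl⟩
  · exact absurd h.1.nil_eq.symm (leaves_ne_nil l)
  rcases w with _ | ⟨b, w⟩
  · exact absurd h.2.nil_eq.symm (leaves_ne_nil r)
  have ha : a ∈ leaves l := h.1.subset (by simp)
  have hb : b ∈ leaves r := h.2.subset (by simp)
  have e : v.concat a ++ b :: w = v ++ a :: b :: w := by simp
  rw [e, pathEdges_append, List.concat_eq_append, edgePairing_join hd _ _ (.inl ⟨ha, hb⟩),
    pairSign_mul_left_right hd ha hb, one_mul]
  · intro e he
    have := mem_of_mem_pathEdges he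
    rw [← List.concat_eq_append] at this
    exact ⟨h.1.subset this.1, h.1.subset this.2⟩
  · intro e he
    have := mem_of_mem_pathEdges he
    exact ⟨h.2.subset this.1, h.2.subset this.2⟩

theorem edgePairing_pathEdges_append' {l r : FreeMagma S} (hd : (leaves l).Disjoint (leaves r))
    {v w : List S} (h : v.Perm (leaves r) ∧ w.Perm (leaves l)) :
    edgePairing (pathEdges (v ++ w)) (l * r) =
      -(edgePairing (pathEdges v) r * edgePairing (pathEdges w) l) := by
  rcases v.eq_nil_or_concat with rfl | ⟨v, a, rfl⟩
  · exact absurd h.1.nil_eq.symm (leaves_ne_nil r)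
  rcases w with _ | ⟨b, w⟩
  · exact absurd h.2.nil_eq.symm (leaves_ne_nil l)
  have ha : a ∈ leaves r := h.1.subset (by simp)
  have hb : b ∈ leaves l := h.2.subset (by simp)
  have e : v.concat a ++ b :: w = v ++ a :: b :: w := by simp
  rw [e, pathEdges_append, List.concat_eq_append, Finset.union_comm,
    edgePairing_join hd _ _ (.inr ⟨ha, hb⟩), pairSign_mul_right_left hd ha hb]
  · ring
  · intro e he
    have := mem_of_mem_pathEdges he
    exact ⟨h.2.subset this.1, h.2.subset this.2⟩
  · intro e he
    have := mem_of_mem_pathEdges he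
    rw [← List.concat_eq_append] at this
    exact ⟨h.1.subset this.1, h.1.subset this.2⟩

/-- Surjectivity requires an edge with nadir at the root, and pigeonhole forbids a second one. The
path therefore changes branch exactly once. -/
theorem split_of_nadirOnto {l r : FreeMagma S} (hlr : (leaves (l * r)).Nodup) {u : List S}
    (hu : u.Perm (leaves (l * r))) (h : NadirOnto (pathEdges u) (l * r)) : ∃ v w, u = v ++ w ∧
      (v.Perm (leaves l) ∧ w.Perm (leaves r) ∨ v.Perm (leaves r) ∧ w.Perm (leaves l)) := by
  have hun : u.Nodup := hu.nodup_iff.mpr hlr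
  have hcard : (pathEdges u).card ≤ (internalVertices (l * r)).card := by
    have := card_internalVertices (l * r)
    rw [card_pathEdges hun, hu.length_eq]
    omega
  rw [leaves_mul] at hu hlr
  obtain ⟨hnl, hnr, hd⟩ := List.nodup_append'.mp hlr
  have nl : ∀ x ∈ leaves l, x ∉ leaves r := fun x hx h => hd hx h
  have nr : ∀ x ∈ leaves r, x ∉ leaves l := fun x hx h => hd h hx
  have hor : ∀ x ∈ u, x ∈ leaves l ∨ x ∈ leaves r :=
    fun x hx => List.mem_append.mp (hu.subset hx)
  obtain ⟨⟨a, b⟩, he, hab⟩ := h [] (by simp [internalVertices_mul])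
  obtain ⟨v, w, rfl⟩ := exists_split_of_mem_pathEdges he
  have e : v ++ a :: b :: w = (v ++ [a]) ++ b :: w := by simp
  have hab' : a ∈ leaves l ∧ b ∈ leaves r ∨ a ∈ leaves r ∧ b ∈ leaves l := by
    dsimp only at hab
    rw [nadir_mul] at hab
    rcases hor a (by simp) with ha | ha <;> rcases hor b (by simp) with hb | hb
    · simp [ha, hb] at hab
    · exact .inl ⟨ha, hb⟩
    · exact .inr ⟨ha, hb⟩
    · simp [ha, hb, nr] at hab
  have hiff : ∀ f ∈ pathEdges (v ++ a :: b :: w), f ≠ (a, b) →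
      ((f.1 ∈ leaves l) ↔ (f.2 ∈ leaves l)) := by
    intro f hf hne
    by_contra hcross
    refine not_nadirOnto_of_nadir_eq hcard hf he hne ?_ h
    rw [hab, nadir_mul, if_neg (by tauto), if_neg]
    rintro ⟨h₁, h₂⟩
    exact hcross ⟨fun h => absurd h₁ (nl _ h), fun h => absurd h₂ (nl _ h)⟩
  have hdvw := hun
  rw [e, List.nodup_append'] at hdvw
  have hv : ∀ f ∈ pathEdges (v ++ [a]), ((f.1 ∈ leaves l) ↔ (f.2 ∈ leaves l)) := by
    intro f hf
    refine hiff f (by rw [pathEdges_append]; simp [hf]) ?_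
    rintro rfl
    exact hdvw.2.2 (mem_of_mem_pathEdges hf).2 (by simp)
  have hw : ∀ f ∈ pathEdges (b :: w), ((f.1 ∈ leaves l) ↔ (f.2 ∈ leaves l)) := by
    intro f hf
    refine hiff f (by rw [pathEdges_append]; simp [hf]) ?_
    rintro rfl
    exact hdvw.2.2 (show a ∈ v ++ [a] by simp) (mem_of_mem_pathEdges hf).1
  have hu' := e ▸ hu
  have hun' := e ▸ hun
  refine ⟨v ++ [a], b :: w, e, ?_⟩
  have hr : ∀ x ∈ v ++ a :: b :: w, x ∉ leaves l → x ∈ leaves r :=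
    fun x hx h => (hor x hx).resolve_left h
  rcases hab' with ⟨ha, hb⟩ | ⟨ha, hb⟩
  · left
    have h₁ := forall_mem_of_pathEdges (P := (· ∈ leaves l)) hv (a := a) (by simp) ha
    have h₂ := forall_mem_of_pathEdges (P := (· ∉ leaves l)) (fun f hf => not_congr (hw f hf))
      (a := b) (by simp) (nr b hb)
    have h₂ : ∀ x ∈ b :: w, x ∈ leaves r := fun x hx =>
      hr x (by rw [e]; exact List.mem_append_right _ hx) (h₂ x hx)
    exact ⟨perm_of_append_perm hd hnl hu' hun' h₁ h₂,
      perm_of_append_perm hd.symm hnr (List.perm_append_comm.trans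
        (hu'.trans List.perm_append_comm)) (List.perm_append_comm.nodup_iff.mp hun') h₂ h₁⟩
  · right
    have h₂ := forall_mem_of_pathEdges (P := (· ∈ leaves l)) hw (a := b) (by simp) hb
    have h₁ := forall_mem_of_pathEdges (P := (· ∉ leaves l)) (fun f hf => not_congr (hv f hf))
      (a := a) (by simp) (nr a ha)
    have h₁ : ∀ x ∈ v ++ [a], x ∈ leaves r := fun x hx =>
      hr x (by rw [e]; exact List.mem_append_left _ hx) (h₁ x hx)
    exact ⟨perm_of_append_perm hd.symm hnr (hu'.trans List.perm_append_comm) hun' h₁ h₂,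
      perm_of_append_perm hd hnl (List.perm_append_comm.trans hu')
        (List.perm_append_comm.nodup_iff.mp hun') h₂ h₁⟩

/-- The configuration pairing of a long graph with a tree is the coefficient of the corresponding
word in the Lie polynomial of the tree. -/
theorem edgePairing_pathEdges {t : FreeMagma S} (ht : (leaves t).Nodup) {u : List S}
    (hu : u.Perm (leaves t)) : edgePairing (pathEdges u) t = wordCoeff t u := by
  induction t using FreeMagma.recOnMul generalizing u with
  | ih1 s =>
    rw [leaves_of, List.perm_singleton] at hu
    subst hu
    have h₁ : edgePairing (pathEdges [s]) (.of s) = 1 := by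
      simp [edgePairing, pathEdges, NadirOnto, internalVertices]
    have h₂ : wordCoeff (.of s) [s] = 1 := Finsupp.single_eq_same
    rw [h₁, h₂]
  | ih2 l r hl hr =>
    obtain ⟨hnl, hnr, hd⟩ := List.nodup_append'.mp (leaves_mul l r ▸ ht)
    -- Both sides obey the same recursion on words that split into a word on each branch, and both
    -- vanish on all other words.
    by_cases h : ∃ v w, u = v ++ w ∧
      (v.Perm (leaves l) ∧ w.Perm (leaves r) ∨ v.Perm (leaves r) ∧ w.Perm (leaves l))
    · obtain ⟨v, w, rfl, h | h⟩ := h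
      · rw [edgePairing_pathEdges_append hd h, wordCoeff_mul_left hd h.1, hl hnl h.1, hr hnr h.2]
      · rw [edgePairing_pathEdges_append' hd h, wordCoeff_mul_right hd h.1, hl hnl h.2,
          hr hnr h.1]
    · have h₁ : edgePairing (pathEdges u) (l * r) = 0 :=
        if_neg fun hon => h (split_of_nadirOnto ht hu hon)
      rw [h₁]
      by_contra hne
      exact h (split_of_wordCoeff_ne_zero (Ne.symm hne))

end PathEdges

/-! ### Constructing graphs: reversal, Arnold triples, paths -/

section LongGraphs

variable {S : Type*}

theorem SGraph.reachable_of_mem {E : Finset (S × S)} {a b : S} (h : (a, b) ∈ E) :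
    (SimpleGraph.fromRel fun a b => (a, b) ∈ E).Reachable a b := by
  by_cases hab : a = b
  · rw [hab]
  · exact SimpleGraph.Adj.reachable ((SimpleGraph.fromRel_adj _ _ _).mpr ⟨hab, .inl h⟩)

theorem SGraph.exists_of_connected [Finite S] {E : Finset (S × S)}
    (hE : ∀ a b, (a, b) ∈ E → (b, a) ∉ E)
    (hconn : (SimpleGraph.fromRel fun a b => (a, b) ∈ E).Connected)
    (hcard : E.card + 1 = Nat.card S) : ∃ H : SGraph S, H.edges = E :=
  ⟨⟨E, hE, SimpleGraph.isTree_iff_connected_and_card.mpr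
    ⟨hconn, by rw [card_edgeSet_fromRel hE, hcard]⟩⟩, rfl⟩

/-- Replacing the edges of a graph by equally many others which connect the same vertices. -/
theorem SGraph.exists_of_reachable [Finite S] (G : SGraph S) {E : Finset (S × S)}
    (hE : ∀ a b, (a, b) ∈ E → (b, a) ∉ E) (hcard : E.card = G.edges.card)
    (h : ∀ a b, (a, b) ∈ G.edges → (SimpleGraph.fromRel fun a b => (a, b) ∈ E).Reachable a b) :
    ∃ H : SGraph S, H.edges = E := by
  refine exists_of_connected hE ?_ (hcard ▸ G.card_edges)
  have hc := G.isTree.connected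
  have := hc.nonempty
  refine ⟨fun a b => ?_⟩
  obtain ⟨w⟩ := hc.preconnected a b
  induction w with
  | nil => rfl
  | cons hadj _ ih =>
    refine SimpleGraph.Reachable.trans ?_ ih
    rcases hadj.2 with h' | h'
    exacts [h _ _ h', (h _ _ h').symm]

theorem SGraph.forall_of_closed (G : SGraph S) {P : S → Prop}
    (h : ∀ a b, (a, b) ∈ G.edges → (P a ↔ P b)) {a : S} (ha : P a) (b : S) : P b := by
  obtain ⟨w⟩ := G.isTree.connected.preconnected a b
  induction w with
  | nil => exact ha
  | cons hadj _ ih =>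
    rcases hadj.2 with h' | h'
    exacts [ih ((h _ _ h').mp ha), ih ((h _ _ h').mpr ha)]

variable [DecidableEq S]

theorem asymm_insert {Q : Finset (S × S)} (hQ : ∀ a b, (a, b) ∈ Q → (b, a) ∉ Q) {x y : S}
    (hxy : x ≠ y) (h : (y, x) ∉ Q) (a b : S) (hab : (a, b) ∈ insert (x, y) Q) :
    (b, a) ∉ insert (x, y) Q := by
  simp only [Finset.mem_insert, Prod.mk.injEq, not_or] at hab ⊢
  rcases hab with ⟨rfl, rfl⟩ | hab
  · exact ⟨fun h' => hxy h'.2, h⟩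
  · exact ⟨fun h' => h (h'.1 ▸ h'.2 ▸ hab), hQ _ _ hab⟩

theorem SGraph.exists_reverse [Finite S] {G : SGraph S} {x y : S} {Q : Finset (S × S)}
    (hG : G.edges = insert (x, y) Q) (hQ : (x, y) ∉ Q) :
    ∃ H : SGraph S, H.edges = insert (y, x) Q ∧ (y, x) ∉ Q ∧ G.ArrowReversed H := by
  have hxy : x ≠ y := G.ne_of_mem (by simp [hG])
  have hyx : (y, x) ∉ Q := fun h => G.asymm x y (by simp [hG]) (by simp [hG, h])
  obtain ⟨H, hH⟩ := G.exists_of_reachable (E := insert (y, x) Q) 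
      (asymm_insert (fun a b h h' => G.asymm a b (by simp [hG, h]) (by simp [hG, h']))
        hxy.symm hQ)
    (by rw [hG, Finset.card_insert_of_notMem hQ, Finset.card_insert_of_notMem hyx]) (by
      intro a b h
      simp only [hG, Finset.mem_insert, Prod.mk.injEq] at h
      rcases h with ⟨rfl, rfl⟩ | h
      · exact (reachable_of_mem (by simp)).symm
      · exact reachable_of_mem (by simp [h]))
  exact ⟨H, hH, hyx, x, y, Q, by simpa using hQ, by simpa using hyx, by rw [hG]; simp,
    by rw [hH]; simp⟩

/-- A tree contains no triangle, so an edge between `c` and `b` is new. Trading one of `b → a`, `a →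
c` for it preserves both connectedness and the number of edges, so the results are trees again. -/
theorem SGraph.exists_arnold [Finite S] {G : SGraph S} {a b c : S} {Q : Finset (S × S)}
    (hG : G.edges = insert (b, a) (insert (a, c) Q)) (hba : (b, a) ∉ Q) (hac : (a, c) ∉ Q)
    (hbc : b ≠ c) :
    ∃ G₂ G₃ : SGraph S, G₂.edges = insert (a, c) (insert (c, b) Q) ∧
      G₃.edges = insert (c, b) (insert (b, a) Q) ∧ (c, b) ∉ Q ∧ Arnold G G₂ G₃ := by
  have mba : (b, a) ∈ G.edges := by simp [hG]
  have mac : (a, c) ∈ G.edges := by simp [hG]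
  have nba : b ≠ a := G.ne_of_mem mba
  have nac : a ≠ c := G.ne_of_mem mac
  have mQ : ∀ e ∈ Q, e ∈ G.edges := fun e he => by simp [hG, he]
  have hclique : ¬(SimpleGraph.fromRel fun a b => (a, b) ∈ G.edges).Adj b c := by
    intro h
    refine G.isTree.isAcyclic.cliqueFree le_rfl {b, a, c} (SimpleGraph.is3Clique_triple_iff.mpr ?_)
    exact ⟨(SimpleGraph.fromRel_adj _ _ _).mpr ⟨nba, .inl mba⟩, h,
      (SimpleGraph.fromRel_adj _ _ _).mpr ⟨nac, .inl mac⟩⟩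
  have hcb : (c, b) ∉ Q := fun h =>
    hclique ((SimpleGraph.fromRel_adj _ _ _).mpr ⟨hbc, .inr (mQ _ h)⟩)
  have hbc' : (b, c) ∉ Q := fun h =>
    hclique ((SimpleGraph.fromRel_adj _ _ _).mpr ⟨hbc, .inl (mQ _ h)⟩)
  have hab : (a, b) ∉ Q := fun h => G.asymm _ _ mba (mQ _ h)
  have hca : (c, a) ∉ Q := fun h => G.asymm _ _ mac (mQ _ h)
  have hQ : ∀ x y, (x, y) ∈ Q → (y, x) ∉ Q := fun x y h h' => G.asymm _ _ (mQ _ h) (mQ _ h')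
  have n₁ : (a, c) ∉ insert (c, b) Q := by simp [hac, nac]
  have n₂ : (c, b) ∉ insert (b, a) Q := by simp [hcb, hbc.symm]
  have n₃ : (b, a) ∉ insert (a, c) Q := by simp [hba, nba]
  obtain ⟨G₂, h₂⟩ := G.exists_of_reachable (E := insert (a, c) (insert (c, b) Q)) (asymm_insert (asymm_insert hQ hbc.symm hbc') nac (by simp [hca, nba.symm]))
    (by rw [hG, Finset.card_insert_of_notMem n₁, Finset.card_insert_of_notMem n₃,
      Finset.card_insert_of_notMem hac, Finset.card_insert_of_notMem hcb]) (by
      intro x y h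
      simp only [hG, Finset.mem_insert, Prod.mk.injEq] at h
      rcases h with ⟨rfl, rfl⟩ | ⟨rfl, rfl⟩ | h
      · exact (reachable_of_mem (a := c) (b := x) (by simp)).symm.trans
          (reachable_of_mem (a := y) (b := c) (by simp)).symm
      · exact reachable_of_mem (by simp)
      · exact reachable_of_mem (by simp [h]))
  obtain ⟨G₃, h₃⟩ := G.exists_of_reachable (E := insert (c, b) (insert (b, a) Q)) (asymm_insert (asymm_insert hQ nba hab) hbc.symm (by simp [hbc', nac.symm]))
    (by rw [hG, Finset.card_insert_of_notMem n₂, Finset.card_insert_of_notMem n₃,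
      Finset.card_insert_of_notMem hac, Finset.card_insert_of_notMem hba]) (by
      intro x y h
      simp only [hG, Finset.mem_insert, Prod.mk.injEq] at h
      rcases h with ⟨rfl, rfl⟩ | ⟨rfl, rfl⟩ | h
      · exact reachable_of_mem (by simp)
      · exact (reachable_of_mem (a := b) (b := x) (by simp)).symm.trans
          (reachable_of_mem (a := y) (b := b) (by simp)).symm
      · exact reachable_of_mem (by simp [h]))
  refine ⟨G₂, G₃, h₂, h₃, hcb, b, a, c, Q, ?_, ?_, ?_, ?_⟩
  · rintro e (rfl | rfl | rfl)
    exacts [by simpa using hba, by simpa using hac, by simpa using hcb]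
  · rw [hG]; simp [Set.insert_union]
  · rw [h₂]; simp [Set.insert_union]
  · rw [h₃]; simp [Set.insert_union]

theorem exists_longGraph [Finite S] {u : List S} (hu : u.Nodup) (hmem : ∀ s, s ∈ u) (hne : u ≠ []) :
    ∃ G : SGraph S, G.edges = pathEdges u := by
  refine SGraph.exists_of_connected ?_ ?_ ?_
  · clear hmem hne
    induction u with
    | nil => simp [pathEdges]
    | cons a u ih =>
      rcases u with _ | ⟨b, u⟩
      · simp [pathEdges]
      · have ha := (List.nodup_cons.mp hu).1
        intro x y h h'
        simp only [pathEdges, Finset.mem_insert, Prod.mk.injEq] at h h'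
        rcases h with ⟨rfl, rfl⟩ | h
        · rcases h' with ⟨rfl, -⟩ | h'
          exacts [ha (by simp), ha (mem_of_mem_pathEdges h').2]
        · rcases h' with ⟨rfl, rfl⟩ | h'
          exacts [ha (mem_of_mem_pathEdges h).2, ih hu.of_cons x y h h']
  · obtain ⟨s, u, rfl⟩ := List.exists_cons_of_ne_nil hne
    have : Nonempty S := ⟨s⟩
    refine ⟨fun a b => ?_⟩
    have key := forall_mem_of_pathEdges (u := s :: u) (a := a)
      (P := (SimpleGraph.fromRel fun x y => (x, y) ∈ pathEdges (s :: u)).Reachable a)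
      (fun e he => ⟨fun h => h.trans (SGraph.reachable_of_mem he),
        fun h => h.trans (SGraph.reachable_of_mem he).symm⟩) (hmem a) .rfl
    exact key b (hmem b)
  · have : Fintype S := ⟨u.toFinset, by simp [hmem]⟩
    have hc : u.toFinset = Finset.univ := by ext; simp [hmem]
    rw [card_pathEdges hu, Nat.card_eq_fintype_card, ← Finset.card_univ, ← hc,
      List.toFinset_card_of_nodup hu]
    have := List.length_pos_iff.mpr hne
    omega

end LongGraphs

/-! ### Long graphs from a fixed vertex span the graphs -/

section Span

variable {K : Type*} [Field K] {n : ℕ}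

theorem single_mem_of_arrowReversed {M : Submodule K (Gr K n)} (hM : eilRelations K n ≤ M)
    {G H : SGraph (Fin n)} (h : G.ArrowReversed H) (hH : Finsupp.single H 1 ∈ M) :
    Finsupp.single G 1 ∈ M :=
  (Submodule.add_mem_iff_left M hH).mp (hM (Submodule.subset_span (.inl ⟨G, H, h, rfl⟩)))

theorem single_mem_of_arnold {M : Submodule K (Gr K n)} (hM : eilRelations K n ≤ M)
    {G₁ G₂ G₃ : SGraph (Fin n)} (h : SGraph.Arnold G₁ G₂ G₃) (h₂ : Finsupp.single G₂ 1 ∈ M)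
    (h₃ : Finsupp.single G₃ 1 ∈ M) : Finsupp.single G₁ 1 ∈ M :=
  (Submodule.add_mem_iff_left M h₂).mp ((Submodule.add_mem_iff_left M h₃).mp
    (hM (Submodule.subset_span (.inr ⟨G₁, G₂, G₃, h, rfl⟩))))

/-- Membership in `M` is insensitive to signs, so edges may be oriented at will before the Arnold
relation is applied. -/
theorem exists_orient {M : Submodule K (Gr K n)} (hM : eilRelations K n ≤ M)
    {G : SGraph (Fin n)} {e e' : Fin n × Fin n} {Q : Finset (Fin n × Fin n)}
    (hG : G.edges = insert e Q) (he : e ∉ Q) (h : e' = e ∨ e' = e.swap) :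
    ∃ H : SGraph (Fin n), H.edges = insert e' Q ∧ e' ∉ Q ∧
      (Finsupp.single H 1 ∈ M → Finsupp.single G 1 ∈ M) := by
  rcases h with rfl | rfl
  · exact ⟨G, hG, he, id⟩
  · obtain ⟨H, h₁, h₂, h₃⟩ := SGraph.exists_reverse (x := e.1) (y := e.2) hG he
    exact ⟨H, h₁, h₂, single_mem_of_arrowReversed hM h₃⟩

theorem fst_mem_of_mem_pathEdges {S : Type*} [DecidableEq S] {p : List S} {a : S} {e : S × S}
    (he : e ∈ pathEdges (p ++ [a])) : e.1 ∈ p := by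
  obtain ⟨v, w, h⟩ := exists_split_of_mem_pathEdges (a := e.1) (b := e.2) he
  rcases w.eq_nil_or_concat with rfl | ⟨w, c, rfl⟩
  · have : p ++ [a] = (v ++ [e.1]) ++ [e.2] := by simpa using h
    rw [(List.append_inj' this rfl).1]
    simp
  · have : p ++ [a] = (v ++ e.1 :: e.2 :: w) ++ [c] := by simpa using h
    rw [(List.append_inj' this rfl).1]
    simp

/-- Once the path exhausts the vertices, an edge of `R` would be a loop at `a`; hence the path is
the whole graph. -/
theorem single_mem_of_covering {M : Submodule K (Gr K n)} {s : Fin n}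
    (hlong : ∀ (G : SGraph (Fin n)) (u : List (Fin n)), u.Nodup → (∀ x, x ∈ u) →
      u.head? = some s → G.edges = pathEdges u → Finsupp.single G 1 ∈ M)
    {p : List (Fin n)} {a : Fin n} {R : Finset (Fin n × Fin n)} {G : SGraph (Fin n)}
    (hp : (p ++ [a]).Nodup) (hs : (p ++ [a]).head? = some s)
    (hG : G.edges = pathEdges (p ++ [a]) ∪ R) (hR : ∀ e ∈ R, e.1 ∉ p ∧ e.2 ∉ p)
    (h : ∀ x, x ∈ p ++ [a]) : Finsupp.single G 1 ∈ M := by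
  refine hlong G (p ++ [a]) hp h hs ?_
  rw [hG, Finset.union_eq_left]
  rintro ⟨x, y⟩ he
  have h₁ := h x
  have h₂ := h y
  simp only [List.mem_append, (hR _ he).1, (hR _ he).2, List.mem_singleton, false_or] at h₁ h₂
  exact absurd (h₁.trans h₂.symm) (G.ne_of_mem (by simp [hG, he]))

/-- A submodule which contains the relations and all long graphs beginning at `s` contains every
graph which begins with a path `p` from `s` to `a` of whose vertices only `a` lies on other
edges. -/
theorem single_mem_of_prefix {M : Submodule K (Gr K n)} (hM : eilRelations K n ≤ M) {s : Fin n}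
    (hlong : ∀ (G : SGraph (Fin n)) (u : List (Fin n)), u.Nodup → (∀ x, x ∈ u) →
      u.head? = some s → G.edges = pathEdges u → Finsupp.single G 1 ∈ M)
    (k m : ℕ) (p : List (Fin n)) (a : Fin n) (R : Finset (Fin n × Fin n)) (G : SGraph (Fin n))
    (hk : n ≤ p.length + 1 + k) (hm : (R.filter fun e => e.1 = a ∨ e.2 = a).card ≤ m)
    (hp : (p ++ [a]).Nodup) (hs : (p ++ [a]).head? = some s)
    (hG : G.edges = pathEdges (p ++ [a]) ∪ R) (hR : ∀ e ∈ R, e.1 ∉ p ∧ e.2 ∉ p) :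
    Finsupp.single G 1 ∈ M := by
  -- The outer induction is on a bound `k` for the number of vertices off the path, the inner one on
  -- a bound `m` for the number of further edges at `a`. Two such edges are reduced by Arnold; a
  -- single one prolongs the path.
  induction k generalizing m p a R G with
  | zero =>
    refine single_mem_of_covering hlong hp hs hG hR fun x => ?_
    have : (p ++ [a]).toFinset = Finset.univ := by
      refine Finset.eq_univ_of_card _ (le_antisymm (Finset.card_le_univ _) ?_)
      rw [List.toFinset_card_of_nodup hp, Fintype.card_fin, List.length_append]
      exact hk
    rw [← List.mem_toFinset, this]
    exact Finset.mem_univ x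
  | succ k ihk =>
    have ha : a ∉ p := fun h => (List.nodup_append'.mp hp).2.2 h (by simp)
    induction m generalizing R G with
    | zero =>
      -- No further edge meets the path, so by connectedness it already contains every vertex.
      refine single_mem_of_covering hlong hp hs hG hR fun x => G.forall_of_closed (P := (· ∈ p ++ [a])) ?_ (a := a) (by simp) x
      intro x y hxy
      rw [hG, Finset.mem_union] at hxy
      rcases hxy with hxy | hxy
      · exact iff_of_true (mem_of_mem_pathEdges hxy).1 (mem_of_mem_pathEdges hxy).2
      · have h₀ := Finset.filter_eq_empty_iff.mp (Finset.card_eq_zero.mp (Nat.le_zero.mp hm)) hxy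
        simp only [not_or] at h₀
        refine iff_of_false ?_ ?_
        · simpa [h₀.1] using (hR _ hxy).1
        · simpa [h₀.2] using (hR _ hxy).2
    | succ m ihm =>
      have hend : ∀ e ∈ R.filter (fun e => e.1 = a ∨ e.2 = a), ∃ c, c ≠ a ∧ c ∉ p ∧
          (e = (a, c) ∨ e = (c, a)) := by
        rintro ⟨x, y⟩ he
        obtain ⟨hxy, h⟩ := Finset.mem_filter.mp he
        have hne := G.ne_of_mem (a := x) (b := y) (by simp [hG, hxy])
        rcases h with h | h
        · exact ⟨y, fun h' => hne (h.trans h'.symm), (hR _ hxy).2, .inl (by rw [← h])⟩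
        · exact ⟨x, fun h' => hne (h'.trans h.symm), (hR _ hxy).1, .inr (by rw [← h])⟩
      have hnotP : ∀ e ∈ R, e ∉ pathEdges (p ++ [a]) :=
        fun e he h => (hR e he).1 (fst_mem_of_mem_pathEdges h)
      rcases (R.filter fun e => e.1 = a ∨ e.2 = a).eq_empty_or_nonempty with h₀ | ⟨e, he⟩
      · exact ihm R G (by simp [h₀]) hG hR
      obtain ⟨c, hca, hcp, hec⟩ := hend e he
      have heR := (Finset.mem_filter.mp he).1
      by_cases h₁ : ∃ e' ∈ R.filter (fun e => e.1 = a ∨ e.2 = a), e' ≠ e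
      · obtain ⟨e', he', hne⟩ := h₁
        obtain ⟨b, hba, hbp, heb⟩ := hend e' he'
        have heR' := (Finset.mem_filter.mp he').1
        set R₀ := (R.erase e').erase e with hR₀
        set Q := pathEdges (p ++ [a]) ∪ R₀ with hQ
        have eG : G.edges = insert e' (insert e Q) := by
          rw [hG, hQ, ← Finset.union_insert, ← Finset.union_insert,
            Finset.insert_erase (Finset.mem_erase.mpr ⟨hne.symm, heR⟩), Finset.insert_erase heR']
        have hbc : b ≠ c := by
          rintro rfl
          have m₁ : e ∈ G.edges := by simp [eG]
          have m₂ : e' ∈ G.edges := by simp [eG]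
          rcases hec with rfl | rfl <;> rcases heb with rfl | rfl
          · exact hne rfl
          · exact G.asymm _ _ m₁ m₂
          · exact G.asymm _ _ m₁ m₂
          · exact hne rfl
        have e'Q : e' ∉ insert e Q := by
          simp [hQ, hR₀, hne, hnotP e' heR']
        have eQ : e ∉ Q := by simp [hQ, hR₀, hnotP e heR]
        obtain ⟨G', h₁, hb, hG'⟩ := exists_orient hM (e' := (b, a)) eG e'Q
          (by rcases heb with rfl | rfl <;> simp)
        rw [Finset.insert_comm] at h₁
        simp only [Finset.mem_insert, not_or] at hb
        obtain ⟨G'', h₂, hc, hG''⟩ := exists_orient hM (e' := (a, c)) h₁ (by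
            simp only [Finset.mem_insert, not_or]
            exact ⟨Ne.symm hb.1, eQ⟩)
          (by rcases hec with rfl | rfl <;> simp)
        rw [Finset.insert_comm] at h₂
        simp only [Finset.mem_insert, not_or] at hc
        obtain ⟨G₂, G₃, h₃, h₄, hcb, harn⟩ := SGraph.exists_arnold h₂ hb.2 hc.2 hbc
        have hcount : (R₀.filter fun e => e.1 = a ∨ e.2 = a).card + 2 ≤ m + 1 := by
          refine le_trans (le_of_eq ?_) hm
          rw [hR₀, Finset.filter_erase, Finset.filter_erase,
            Finset.card_erase_of_mem (Finset.mem_erase.mpr ⟨hne.symm, he⟩),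
            Finset.card_erase_of_mem he']
          have : 1 < (R.filter fun e => e.1 = a ∨ e.2 = a).card :=
            Finset.one_lt_card.mpr ⟨e', he', e, he, hne⟩
          omega
        -- In each of the two new graphs only one of the edges at `a` returns, and the edge from `c`
        -- to `b` avoids `a`; so the count at `a` has dropped.
        have hcount' : ∀ f : Fin n × Fin n, ((insert f (insert (c, b) R₀)).filter
            fun e => e.1 = a ∨ e.2 = a).card ≤ m := by
          intro f
          have h₀ : ¬(c = a ∨ b = a) := by simp [hca, hba]
          rw [Finset.filter_insert, Finset.filter_insert, if_neg h₀]
          split_ifs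
          · exact (Finset.card_insert_le _ _).trans (by omega)
          · omega
        have hR₀' : ∀ f : Fin n × Fin n, f.1 ∉ p → f.2 ∉ p →
            ∀ e ∈ insert f (insert (c, b) R₀), e.1 ∉ p ∧ e.2 ∉ p := by
          intro f hf₁ hf₂ e he
          simp only [Finset.mem_insert] at he
          rcases he with rfl | rfl | he
          · exact ⟨hf₁, hf₂⟩
          · exact ⟨hcp, hbp⟩
          · exact hR e (Finset.mem_of_mem_erase (Finset.mem_of_mem_erase he))
        have h₃' : G₂.edges = pathEdges (p ++ [a]) ∪ insert (a, c) (insert (c, b) R₀) := by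
          rw [h₃, hQ, Finset.union_insert, Finset.union_insert]
        have h₄' : G₃.edges = pathEdges (p ++ [a]) ∪ insert (b, a) (insert (c, b) R₀) := by
          rw [h₄, hQ, Finset.union_insert, Finset.union_insert, Finset.insert_comm]
        have r₃ := hR₀' (a, c) ha hcp
        have r₄ := hR₀' (b, a) hbp ha
        exact hG' (hG'' (single_mem_of_arnold hM harn
          (ihm _ G₂ (hcount' _) h₃' r₃)
          (ihm _ G₃ (hcount' _) h₄' r₄)))
      · push Not at h₁
        have eG : G.edges = insert e (pathEdges (p ++ [a]) ∪ R.erase e) := by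
          rw [hG, ← Finset.union_insert, Finset.insert_erase heR]
        obtain ⟨G', h₂, -, hG'⟩ := exists_orient hM (e' := (a, c)) eG
          (by simp [hnotP e heR]) (by rcases hec with rfl | rfl <;> simp)
        have e' : p ++ [a] ++ [c] = p ++ a :: c :: [] := by simp
        -- The path now ends at `c`, and the inner bound starts afresh with the number of edges
        -- there.
        refine hG' (ihk _ (p ++ [a]) c (R.erase e) G' ?_ le_rfl ?_ ?_ ?_ ?_)
        · rw [List.length_append, List.length_singleton]
          omega
        · rw [List.nodup_append']
          refine ⟨hp, by simp, fun x hx hx' => ?_⟩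
          rw [List.mem_singleton.mp hx'] at hx
          simp [hca, hcp] at hx
        · rw [← hs]
          cases p <;> rfl
        · rw [e', pathEdges_append, h₂, Finset.insert_union]
          simp [pathEdges]
        · intro f hf
          obtain ⟨hfe, hfR⟩ := Finset.mem_erase.mp hf
          have h₃ : ¬(f.1 = a ∨ f.2 = a) := fun h =>
            hfe (h₁ f (Finset.mem_filter.mpr ⟨hfR, h⟩))
          simp only [not_or] at h₃
          simp [hR f hfR, h₃]

/-- The graphs are spanned, modulo the relations, by the long graphs beginning at `s`. -/
theorem single_mem_of_longGraph {M : Submodule K (Gr K n)} (hM : eilRelations K n ≤ M) {s : Fin n}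
    (hlong : ∀ (G : SGraph (Fin n)) (u : List (Fin n)), u.Nodup → (∀ x, x ∈ u) →
      u.head? = some s → G.edges = pathEdges u → Finsupp.single G 1 ∈ M)
    (G : SGraph (Fin n)) : Finsupp.single G 1 ∈ M :=
  single_mem_of_prefix hM hlong n _ [] s G.edges G (by simp) le_rfl (by simp) (by simp)
    (by simp [pathEdges]) (by simp)

end Span

/-! ### Left combs span, in the free magma algebra where subtrees may carry any labels -/

section Combs

variable {S : Type*}

theorem perm_leaves_of_branchSwap {t t' : FreeMagma S} (h : BranchSwap t t') :
    (leaves t).Perm (leaves t') := by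
  induction h with
  | root t₁ t₂ => exact List.perm_append_comm
  | left r h ih => exact ih.append_right _
  | right l h ih => exact ih.append_left _

theorem perm_leaves_of_jacobi {t t' t'' : FreeMagma S} (h : Jacobi t t' t'') :
    (leaves t).Perm (leaves t') ∧ (leaves t).Perm (leaves t'') := by
  induction h with
  | root t₁ t₂ t₃ =>
    simp only [leaves_mul]
    constructor
    · rw [List.append_assoc]
      exact List.perm_append_comm
    · rw [List.append_assoc (leaves t₃)]
      exact List.perm_append_comm
  | left r h ih => exact ⟨ih.1.append_right _, ih.2.append_right _⟩
  | right l h ih => exact ⟨ih.1.append_left _, ih.2.append_left _⟩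

/-- The anti-symmetry and Jacobi expressions in the free magma algebra. -/
def magmaRelations (K : Type*) [Field K] (S : Type*) : Submodule K (FreeMagma S →₀ K) :=
  Submodule.span K
    ({x | ∃ t t' : FreeMagma S, BranchSwap t t' ∧ x = Finsupp.single t 1 + Finsupp.single t' 1} ∪
     {x | ∃ t t' t'' : FreeMagma S, Jacobi t t' t'' ∧
        x = Finsupp.single t 1 + Finsupp.single t' 1 + Finsupp.single t'' 1})

variable {K : Type*} [Field K]

theorem single_mem_of_branchSwap {M : Submodule K (FreeMagma S →₀ K)}
    (hM : magmaRelations K S ≤ M) {t t' : FreeMagma S} (h : BranchSwap t t')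
    (h' : Finsupp.single t' 1 ∈ M) : Finsupp.single t 1 ∈ M :=
  (Submodule.add_mem_iff_left M h').mp (hM (Submodule.subset_span (.inl ⟨t, t', h, rfl⟩)))

theorem single_mem_of_jacobi {M : Submodule K (FreeMagma S →₀ K)}
    (hM : magmaRelations K S ≤ M) {t t' t'' : FreeMagma S} (h : Jacobi t t' t'')
    (h' : Finsupp.single t' 1 ∈ M) (h'' : Finsupp.single t'' 1 ∈ M) : Finsupp.single t 1 ∈ M :=
  (Submodule.add_mem_iff_left M h').mp ((Submodule.add_mem_iff_left M h'').mp
    (hM (Submodule.subset_span (.inr ⟨t, t', t'', h, rfl⟩))))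

theorem mul_right_mem_magmaRelations (r : FreeMagma S) {x : FreeMagma S →₀ K}
    (hx : x ∈ magmaRelations K S) :
    Finsupp.lmapDomain K K (· * r) x ∈ magmaRelations K S := by
  induction hx using Submodule.span_induction with
  | mem x hx =>
    rcases hx with ⟨t, t', h, rfl⟩ | ⟨t, t', t'', h, rfl⟩
    · exact Submodule.subset_span (.inl ⟨_, _, h.left r, by simp [Finsupp.mapDomain_add]⟩)
    · exact Submodule.subset_span (.inr ⟨_, _, _, h.left r, by simp [Finsupp.mapDomain_add]⟩)
  | zero => simp
  | add x y _ _ hx hy => simpa [Finsupp.mapDomain_add] using add_mem hx hy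
  | smul a x _ hx => simpa using Submodule.smul_mem _ a hx

/-- The span of the relations and of the left combs which begin with `t`. -/
def combSpan (K : Type*) [Field K] (t : FreeMagma S) : Submodule K (FreeMagma S →₀ K) :=
  magmaRelations K S ⊔ Submodule.span K (Set.range fun L : List S => Finsupp.single (comb t L) 1)

theorem combSpan_comb_le (t : FreeMagma S) (L : List S) :
    combSpan K (comb t L) ≤ combSpan K t := by
  refine sup_le le_sup_left (le_trans (Submodule.span_mono ?_) le_sup_right)
  rintro _ ⟨L', rfl⟩
  exact ⟨L ++ L', congrArg (fun t => Finsupp.single t 1) (comb_append t L L')⟩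

/-- To show that right multiplication by `r` maps the combs on `t` to a submodule it suffices to
consider the combs. -/
theorem mul_right_mem {t l r : FreeMagma S} {M : Submodule K (FreeMagma S →₀ K)}
    (hM : magmaRelations K S ≤ M) (hl : Finsupp.single l 1 ∈ combSpan K t)
    (h : ∀ L, Finsupp.single (comb t L * r) 1 ∈ M) : Finsupp.single (l * r) 1 ∈ M := by
  have hle : combSpan K t ≤ M.comap (Finsupp.lmapDomain K K (· * r)) := by
    refine sup_le (fun x hx => hM (mul_right_mem_magmaRelations r hx)) ?_
    rw [Submodule.span_le]
    rintro _ ⟨L, rfl⟩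
    simpa using h L
  simpa using hle hl

/-- By Jacobi and anti-symmetry, `x * (l * r)` is a combination of `(x * l) * r` and `(x * r) * l`,
in which smaller trees are multiplied onto the left factor. The induction needs `x` arbitrary
because that factor grows into a comb. -/
theorem single_mul_mem_combSpan (x t : FreeMagma S) :
    Finsupp.single (x * t) 1 ∈ combSpan K x := by
  induction t using FreeMagma.recOnMul generalizing x with
  | ih1 s => exact Submodule.mem_sup_right (Submodule.subset_span ⟨[s], rfl⟩)
  | ih2 l r hl hr =>
    have h₁ : Finsupp.single ((x * l) * r) 1 ∈ combSpan K x :=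
      mul_right_mem le_sup_left (hl x) fun L => combSpan_comb_le x L (hr _)
    have h₂ : Finsupp.single ((x * r) * l) 1 ∈ combSpan K x :=
      mul_right_mem le_sup_left (hr x) fun L => combSpan_comb_le x L (hl _)
    have hM : magmaRelations K S ≤ combSpan K x := le_sup_left
    have h₃ : Finsupp.single ((r * x) * l) 1 ∈ combSpan K x :=
      single_mem_of_branchSwap hM (.left l (.root r x)) h₂
    have h₄ : Finsupp.single ((l * r) * x) 1 ∈ combSpan K x :=
      single_mem_of_jacobi hM (.root l r x) h₃ h₁
    exact single_mem_of_branchSwap hM (.root x (l * r)) h₄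

/-- Every tree with a leaf `s` is, modulo the relations, a combination of left combs beginning at
`s`. -/
theorem single_mem_combSpan {s : S} {t : FreeMagma S} (hs : s ∈ leaves t) :
    Finsupp.single t 1 ∈ combSpan K (.of s : FreeMagma S) := by
  have hM : magmaRelations K S ≤ combSpan K (.of s : FreeMagma S) := le_sup_left
  induction t using FreeMagma.recOnMul with
  | ih1 a =>
    rw [leaves_of, List.mem_singleton] at hs
    subst hs
    exact Submodule.mem_sup_right (Submodule.subset_span ⟨[], rfl⟩)
  | ih2 l r hl hr =>
    rw [leaves_mul, List.mem_append] at hs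
    rcases hs with hs | hs
    · exact mul_right_mem hM (hl hs) fun L =>
        combSpan_comb_le _ L (single_mul_mem_combSpan _ _)
    · exact single_mem_of_branchSwap hM (.root l r) (mul_right_mem hM (hr hs) fun L =>
        combSpan_comb_le _ L (single_mul_mem_combSpan _ _))

end Combs

/-! ### Transfer to trees with bijective labels -/

section TreeSpan

variable {K : Type*} [Field K] {n : ℕ}

open Classical in
/-- The projection of the free magma algebra to the space of trees with leaves labelled by
`Fin n`. -/
def toTr (K : Type*) [Field K] (n : ℕ) : (FreeMagma (Fin n) →₀ K) →ₗ[K] Tr K n :=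
  Finsupp.lift (Tr K n) K (FreeMagma (Fin n)) fun t =>
    if h : (leaves t).Nodup ∧ ∀ s, s ∈ leaves t then Finsupp.single ⟨t, h.1, h.2⟩ 1 else 0

theorem toTr_single (T : STree (Fin n)) :
    toTr K n (Finsupp.single T.tree 1) = Finsupp.single T 1 := by
  simp [toTr, T.nodup, T.complete]

theorem toTr_single_of_not {t : FreeMagma (Fin n)}
    (h : ¬((leaves t).Nodup ∧ ∀ s, s ∈ leaves t)) : toTr K n (Finsupp.single t 1) = 0 := by
  simp [toTr, h]

theorem nodup_and_complete_congr {S : Type*} {L L' : List S} (h : L.Perm L') :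
    (L.Nodup ∧ ∀ s, s ∈ L) ↔ (L'.Nodup ∧ ∀ s, s ∈ L') := by
  rw [h.nodup_iff]
  simp [h.mem_iff]

/-- All terms of a relation have the same leaves up to order, so the projection keeps all of them or
none. -/
theorem toTr_mem_lieRelations {x : FreeMagma (Fin n) →₀ K}
    (hx : x ∈ magmaRelations K (Fin n)) : toTr K n x ∈ lieRelations K n := by
  induction hx using Submodule.span_induction with
  | mem x hx =>
    rcases hx with ⟨t, t', h, rfl⟩ | ⟨t, t', t'', h, rfl⟩
    · have e := nodup_and_complete_congr (perm_leaves_of_branchSwap h)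
      by_cases ht : (leaves t).Nodup ∧ ∀ s, s ∈ leaves t
      · have ht' := e.mp ht
        rw [map_add, toTr_single ⟨t, ht.1, ht.2⟩, toTr_single ⟨t', ht'.1, ht'.2⟩]
        exact Submodule.subset_span (.inl ⟨_, _, h, rfl⟩)
      · rw [map_add, toTr_single_of_not ht, toTr_single_of_not (e.not.mp ht), add_zero]
        exact zero_mem _
    · have e := nodup_and_complete_congr (perm_leaves_of_jacobi h).1
      have e' := nodup_and_complete_congr (perm_leaves_of_jacobi h).2
      by_cases ht : (leaves t).Nodup ∧ ∀ s, s ∈ leaves t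
      · have ht' := e.mp ht
        have ht'' := e'.mp ht
        rw [map_add, map_add, toTr_single ⟨t, ht.1, ht.2⟩, toTr_single ⟨t', ht'.1, ht'.2⟩,
          toTr_single ⟨t'', ht''.1, ht''.2⟩]
        exact Submodule.subset_span (.inr ⟨_, _, _, h, rfl⟩)
      · rw [map_add, map_add, toTr_single_of_not ht, toTr_single_of_not (e.not.mp ht),
          toTr_single_of_not (e'.not.mp ht), add_zero, add_zero]
        exact zero_mem _
  | zero => simp
  | add x y _ _ hx hy => simpa using add_mem hx hy
  | smul a x _ hx => simpa using Submodule.smul_mem _ a hx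

/-- The trees are spanned, modulo the relations, by the left combs beginning at `s`. -/
theorem single_mem_of_comb {M : Submodule K (Tr K n)} (hM : lieRelations K n ≤ M) {s : Fin n}
    (hcomb : ∀ (T : STree (Fin n)) (L : List (Fin n)), T.tree = comb (.of s) L →
      Finsupp.single T 1 ∈ M) (T : STree (Fin n)) : Finsupp.single T 1 ∈ M := by
  have hle : combSpan K (.of s : FreeMagma (Fin n)) ≤ M.comap (toTr K n) := by
    refine sup_le (fun x hx => hM (toTr_mem_lieRelations hx)) ?_
    rw [Submodule.span_le]
    rintro _ ⟨L, rfl⟩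
    change toTr K n _ ∈ M
    by_cases h : (leaves (comb (.of s) L)).Nodup ∧ ∀ a, a ∈ leaves (comb (.of s) L)
    · rw [toTr_single ⟨_, h.1, h.2⟩]
      exact hcomb _ L rfl
    · rw [toTr_single_of_not h]
      exact zero_mem _
  rw [← toTr_single]
  exact hle (single_mem_combSpan (T.complete s))

end TreeSpan

/-! ### Duality of graphs and trees modulo relations -/

section Duality

variable {K : Type*} [Field K] {n : ℕ}

/-- The configuration pairing as a bilinear form. -/
def configForm (K : Type*) [Field K] (n : ℕ) : Gr K n →ₗ[K] Tr K n →ₗ[K] K :=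
  Finsupp.lift _ K _ fun G => Finsupp.lift K K _ fun T => (configPairing G T : K)

theorem configForm_single (G : SGraph (Fin n)) (T : STree (Fin n)) :
    configForm K n (Finsupp.single G 1) (Finsupp.single T 1) = configPairing G T := by
  simp [configForm]

theorem eilRelations_le_ker : eilRelations K n ≤ LinearMap.ker (configForm K n) := by
  refine Submodule.span_le.mpr ?_
  rintro _ (⟨G, H, h, rfl⟩ | ⟨G₁, G₂, G₃, h, rfl⟩) <;>
    refine LinearMap.mem_ker.mpr (Finsupp.lhom_ext' fun T => LinearMap.ext_ring ?_)
  · simp only [map_add, LinearMap.add_apply, LinearMap.comp_apply, Finsupp.lsingle_apply,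
      configForm_single, LinearMap.zero_apply]
    rw [← Int.cast_add, configPairing_arrowReversed h T, Int.cast_zero]
  · simp only [map_add, LinearMap.add_apply, LinearMap.comp_apply, Finsupp.lsingle_apply,
      configForm_single, LinearMap.zero_apply]
    rw [← Int.cast_add, ← Int.cast_add, configPairing_arnold h T, Int.cast_zero]

theorem perm_leaves (T : STree (Fin n)) {u : List (Fin n)} (hu : u.Nodup) (hmem : ∀ x, x ∈ u) :
    u.Perm (leaves T.tree) :=
  (List.perm_ext_iff_of_nodup hu T.nodup).mpr fun x => iff_of_true (hmem x) (T.complete x)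

theorem configPairing_longGraph {G : SGraph (Fin n)} {u : List (Fin n)} (hu : u.Nodup)
    (hmem : ∀ x, x ∈ u) (hG : G.edges = pathEdges u) (T : STree (Fin n)) :
    configPairing G T = wordCoeff T.tree u := by
  rw [configPairing_eq, hG, edgePairing_pathEdges T.nodup (perm_leaves T hu hmem)]

/-- The graph relations being in the kernel already, it is enough to test against long graphs. There
the pairing is a coefficient of the Lie polynomial, and the tree relations hold for Lie polynomials.
-/
theorem lieRelations_le_ker : lieRelations K n ≤ LinearMap.ker (configForm K n).flip := by
  have hflip : ∀ x : Tr K n, (∀ (G : SGraph (Fin n)) (u : List (Fin n)), u.Nodup → (∀ x, x ∈ u) →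
      G.edges = pathEdges u → configForm K n (Finsupp.single G 1) x = 0) →
      x ∈ LinearMap.ker (configForm K n).flip := by
    intro x hx
    refine LinearMap.mem_ker.mpr (Finsupp.lhom_ext' fun G => LinearMap.ext_ring ?_)
    change configForm K n (Finsupp.single G 1) x = 0
    rcases n with _ | n
    · exact isEmptyElim (G.isTree.connected.nonempty.some)
    have hM : eilRelations K (n + 1) ≤ LinearMap.ker ((configForm K (n + 1)).flip x) := by
      intro y hy
      have := LinearMap.mem_ker.mp (eilRelations_le_ker hy)
      simp [this]
    exact single_mem_of_longGraph (s := 0) hM (fun G u h₁ h₂ _ h₃ => hx G u h₁ h₂ h₃) G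
  refine Submodule.span_le.mpr ?_
  rintro _ (⟨T, T', h, rfl⟩ | ⟨T₁, T₂, T₃, h, rfl⟩) <;> refine hflip _ fun G u hu hmem hG => ?_
  · rw [map_add, configForm_single, configForm_single, configPairing_longGraph hu hmem hG,
      configPairing_longGraph hu hmem hG]
    have := congrArg (fun p => p.coeff (FreeMonoid.ofList u)) (bracketPoly_branchSwap h)
    have : wordCoeff T.tree u + wordCoeff T'.tree u = 0 := this
    rw [← Int.cast_add, this, Int.cast_zero]
  · rw [map_add, map_add, configForm_single, configForm_single, configForm_single,
      configPairing_longGraph hu hmem hG, configPairing_longGraph hu hmem hG,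
      configPairing_longGraph hu hmem hG]
    have := congrArg (fun p => p.coeff (FreeMonoid.ofList u)) (bracketPoly_jacobi h)
    have : wordCoeff T₁.tree u + wordCoeff T₂.tree u + wordCoeff T₃.tree u = 0 := this
    rw [← Int.cast_add, ← Int.cast_add, this, Int.cast_zero]

/-- Dual families which span the graphs and the trees modulo the relations. -/
theorem exists_dual_families (K : Type*) [Field K] (n : ℕ) :
    ∃ (ι : Type) (g : ι → SGraph (Fin n)) (t : ι → STree (Fin n)),
      (∀ i, configForm K n (Finsupp.single (g i) 1) (Finsupp.single (t i) 1) = 1) ∧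
      (∀ i j, i ≠ j → configForm K n (Finsupp.single (g i) 1) (Finsupp.single (t j) 1) = 0) ∧
      (∀ G, Finsupp.single G 1 ∈ eilRelations K n ⊔
        Submodule.span K (Set.range fun i => Finsupp.single (g i) (1 : K))) ∧
      (∀ T, Finsupp.single T 1 ∈ lieRelations K n ⊔
        Submodule.span K (Set.range fun i => Finsupp.single (t i) (1 : K))) := by
  -- In weight zero there are neither graphs nor trees; otherwise the label `0` serves as the fixed
  -- starting vertex.
  rcases n with _ | n
  · refine ⟨PEmpty, PEmpty.elim, PEmpty.elim, fun i => i.elim, fun i => i.elim, fun G => ?_,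
      fun T => ?_⟩
    · exact isEmptyElim (G.isTree.connected.nonempty.some)
    · obtain ⟨a, ha⟩ := List.exists_mem_of_ne_nil _ (leaves_ne_nil T.tree)
      exact isEmptyElim a
  -- The common index is an ordering of the labels other than `0`: it determines both a long graph
  -- and a comb.
  let ι := {L : List (Fin (n + 1)) // ((0 : Fin (n + 1)) :: L).Nodup ∧
    ∀ x, x ∈ (0 : Fin (n + 1)) :: L}
  have hg : ∀ i : ι, ∃ G : SGraph (Fin (n + 1)), G.edges = pathEdges (0 :: i.1) :=
    fun i => exists_longGraph i.2.1 i.2.2 (List.cons_ne_nil _ _)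
  choose g hg using hg
  let t : ι → STree (Fin (n + 1)) := fun i => ⟨comb (.of 0) i.1,
    by rw [leaves_comb]; exact i.2.1, by rw [leaves_comb]; exact i.2.2⟩
  have hgt : ∀ i j, configForm K (n + 1) (Finsupp.single (g i) 1) (Finsupp.single (t j) 1) =
      ((if i.1 = j.1 then 1 else 0 : ℤ) : K) := by
    intro i j
    rw [configForm_single, configPairing_longGraph i.2.1 i.2.2 (hg i),
      wordCoeff_comb (List.nodup_cons.mp j.2.1).1]
  refine ⟨ι, g, t, fun i => by simp [hgt], fun i j hij => ?_, fun G => ?_, fun T => ?_⟩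
  · rw [hgt, if_neg fun h => hij (Subtype.ext h), Int.cast_zero]
  · refine single_mem_of_longGraph (s := 0) le_sup_left (fun G u hu hmem hs hG => ?_) G
    rcases u with _ | ⟨a, L⟩
    · simp at hs
    obtain rfl : a = 0 := by simpa using hs
    refine Submodule.mem_sup_right (Submodule.subset_span ⟨⟨L, hu, hmem⟩, ?_⟩)
    have : g ⟨L, hu, hmem⟩ = G := SGraph.ext ((hg _).trans hG.symm)
    simp only [this]
  · refine single_mem_of_comb (s := 0) le_sup_left (fun T L hT => ?_) T
    have hn := T.nodup
    have hc := T.complete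
    rw [hT, leaves_comb] at hn
    simp only [hT, leaves_comb] at hc
    refine Submodule.mem_sup_right (Submodule.subset_span ⟨⟨L, hn, hc⟩, ?_⟩)
    have : t ⟨L, hn, hc⟩ = T := STree.ext hT.symm
    simp only [this]

end Duality

/-! ### Koszul signs -/

section KoszulSign

variable {n : ℕ}

theorem negOnePow_congr {a b : ℤ} (h : Even a ↔ Even b) : a.negOnePow = b.negOnePow := by
  by_cases ha : Even a
  · rw [Int.negOnePow_even _ ha, Int.negOnePow_even _ (h.mp ha)]
  · rw [Int.negOnePow_odd _ (Int.not_even_iff_odd.mp ha),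
      Int.negOnePow_odd _ (Int.not_even_iff_odd.mp (h.not.mp ha))]

theorem koszulSign_congr {d d' : Fin n → ℤ} (h : ∀ i, Even (d i) ↔ Even (d' i))
    (σ : Equiv.Perm (Fin n)) : koszulSign d σ = koszulSign d' σ := by
  unfold koszulSign
  have : ∀ i j, (d i * d j).negOnePow = (d' i * d' j).negOnePow := fun i j =>
    negOnePow_congr (by rw [Int.even_mul, Int.even_mul, h i, h j])
  simp only [this]

theorem koszulSign_one (d : Fin n → ℤ) : koszulSign d 1 = 1 := by
  refine Finset.prod_eq_one fun i _ => Finset.prod_eq_one fun j _ => if_neg ?_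
  rintro ⟨h, h'⟩
  exact lt_asymm h h'

theorem koszulSign_mul_self (d : Fin n → ℤ) (σ : Equiv.Perm (Fin n)) :
    koszulSign d σ * koszulSign d σ = 1 := by
  unfold koszulSign
  rw [← Finset.prod_mul_distrib]
  refine Finset.prod_eq_one fun i _ => ?_
  rw [← Finset.prod_mul_distrib]
  refine Finset.prod_eq_one fun j _ => ?_
  split_ifs
  · rw [← Units.val_mul, Int.units_mul_self, Units.val_one]
  · rfl

/-- Gathers `(i, j)` with `(j, i)`, so that products over pairs can be compared even after a
permutation has reversed some of them. -/
theorem prod_prod_eq_prod_lt (f : Fin n → Fin n → ℤ) (hf : ∀ i, f i i = 1) :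
    ∏ i, ∏ j, f i j = ∏ i, ∏ j, if i < j then f i j * f j i else 1 := by
  have h : ∀ i j, f i j = (if i < j then f i j else 1) * (if j < i then f i j else 1) := by
    intro i j
    rcases lt_trichotomy i j with h | rfl | h
    · simp [h, h.not_gt]
    · simp [hf]
    · simp [h, h.not_gt]
  have h' : ∀ i j, (if i < j then f i j * f j i else 1) =
      (if i < j then f i j else 1) * (if i < j then f j i else 1) := by
    intro i j
    split_ifs <;> simp
  simp only [h']
  simp only [Finset.prod_mul_distrib]
  rw [Finset.prod_comm (f := fun i j => if i < j then f j i else 1)]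
  simp only [← Finset.prod_mul_distrib, ← h]

/-- A pair is inverted by `τ * σ` exactly when one, but not both, of the two successive moves
inverts it; a double inversion contributes the square of a sign. -/
theorem koszulSign_mul (d : Fin n → ℤ) (τ σ : Equiv.Perm (Fin n)) :
    koszulSign d (τ * σ) = koszulSign (fun i => d (σ.symm i)) τ * koszulSign d σ := by
  have e : koszulSign (fun i => d (σ.symm i)) τ = ∏ i, ∏ j,
      if σ i < σ j ∧ τ (σ j) < τ (σ i) then (((d i * d j).negOnePow : ℤˣ) : ℤ) else 1 := by
    unfold koszulSign
    rw [← Equiv.prod_comp σ]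
    refine Finset.prod_congr rfl fun i _ => ?_
    rw [← Equiv.prod_comp σ]
    simp
  rw [e, prod_prod_eq_prod_lt _ (by simp)]
  unfold koszulSign
  rw [← Finset.prod_mul_distrib]
  refine Finset.prod_congr rfl fun i _ => ?_
  rw [← Finset.prod_mul_distrib]
  refine Finset.prod_congr rfl fun j _ => ?_
  by_cases hij : i < j
  · have h₁ : σ i ≠ σ j := fun h => hij.ne (σ.injective h)
    have h₂ : τ (σ i) ≠ τ (σ j) := fun h => h₁ (τ.injective h)
    have hs : (((d i * d j).negOnePow : ℤˣ) : ℤ) * (((d i * d j).negOnePow : ℤˣ) : ℤ) = 1 := by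
      rw [← Units.val_mul, Int.units_mul_self, Units.val_one]
    simp only [hij, true_and, if_true, mul_comm (d j) (d i), Equiv.Perm.mul_apply]
    rcases lt_or_gt_of_ne h₁ with h₁ | h₁ <;> rcases lt_or_gt_of_ne h₂ with h₂ | h₂ <;>
      simp [h₁, h₂, h₁.not_gt, h₂.not_gt, hs]
  · simp [hij]

end KoszulSign

/-! ### Nondegeneracy on tensor powers, in any dimension -/

section TensorPower

variable {K : Type*} [Field K] {W : Type*} [AddCommGroup W] [Module K W]
  {V : Type*} [AddCommGroup V] [Module K V]

/-- The pairing of tensor powers induced by a pairing. -/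
def tensorPairing (B : W →ₗ[K] V →ₗ[K] K) (n : ℕ) :
    (⨂[K] _ : Fin n, W) →ₗ[K] (⨂[K] _ : Fin n, V) →ₗ[K] K :=
  PiTensorProduct.dualDistrib ∘ₗ PiTensorProduct.map fun _ => B

theorem tensorPairing_tprod (B : W →ₗ[K] V →ₗ[K] K) {n : ℕ} (w : Fin n → W) (v : Fin n → V) :
    tensorPairing B n (PiTensorProduct.tprod K w) (PiTensorProduct.tprod K v) =
      ∏ i, B (w i) (v i) := by
  rw [tensorPairing, LinearMap.comp_apply, PiTensorProduct.map_tprod]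
  exact PiTensorProduct.dualDistrib_apply _ _

theorem tensorPairing_flip (B : W →ₗ[K] V →ₗ[K] K) (n : ℕ) :
    (tensorPairing B n).flip = tensorPairing B.flip n := by
  refine PiTensorProduct.ext (MultilinearMap.ext fun v => ?_)
  refine PiTensorProduct.ext (MultilinearMap.ext fun w => ?_)
  simp only [LinearMap.compMultilinearMap_apply, LinearMap.flip_apply, tensorPairing_tprod]

/-- Dual vectors to a finite part of a basis. -/
theorem exists_dual_vector {B : W →ₗ[K] V →ₗ[K] K} (hB : B.SeparatingLeft) {ι : Type*}
    {b : ι → W} (hb : LinearIndependent K b) (s : Finset ι) (i : ι) :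
    ∃ v, B (b i) v = 1 ∧ ∀ j ∈ s, j ≠ i → B (b j) v = 0 := by
  classical
  have hBb : LinearIndependent K fun j => B (b j) :=
    hb.map' B (LinearMap.separatingLeft_iff_ker_eq_bot.mp hB)
  have hnot : B (b i) ∉ Submodule.span K (Set.range fun j : {j // j ∈ s ∧ j ≠ i} => B (b j)) := by
    intro h
    refine hBb.notMem_span_image (s := {j | j ∈ s ∧ j ≠ i}) (x := i) (by simp) ?_
    convert h using 2
    ext f
    simp
  have : Finite {j // j ∈ s ∧ j ≠ i} :=
    Finite.of_injective (fun j => (⟨j.1, j.2.1⟩ : {j // j ∈ s}))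
      fun j k h => Subtype.ext (congrArg (fun x : {j // j ∈ s} => x.1) h)
  -- A functional vanishing on the common kernel of finitely many others is a combination of them,
  -- which the independence of the `B (b j)` excludes.
  have hk : ¬(⨅ j : {j // j ∈ s ∧ j ≠ i}, LinearMap.ker (B (b j)) ≤ LinearMap.ker (B (b i))) :=
    fun h => hnot (mem_span_of_iInf_ker_le_ker h)
  obtain ⟨v, hv, hv'⟩ := SetLike.not_le_iff_exists.mp hk
  simp only [Submodule.mem_iInf, LinearMap.mem_ker, Subtype.forall] at hv hv'
  refine ⟨(B (b i) v)⁻¹ • v, by simp [hv'], fun j hj hji => ?_⟩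
  rw [map_smul, hv j ⟨hj, hji⟩, smul_zero]

/-- Only finitely many basis vectors occur in `x`. A pure tensor of vectors dual to these extracts
any chosen coefficient of `x`. -/
theorem tensorPairing_separatingLeft {B : W →ₗ[K] V →ₗ[K] K} (hB : B.SeparatingLeft) (n : ℕ) :
    (tensorPairing B n).SeparatingLeft := by
  classical
  intro x hx
  let b := Module.Basis.ofVectorSpace K W
  let b' := Basis.piTensorProduct (ι := Fin n) fun _ => b
  refine b'.ext_elem fun p => ?_
  rw [map_zero, Finsupp.zero_apply]
  let s : Finset _ := (b'.repr x).support.biUnion fun q => Finset.univ.image q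
  choose v hv hv' using fun i => exists_dual_vector hB b.linearIndependent s (p i)
  have h := hx (PiTensorProduct.tprod K v)
  rw [← b'.linearCombination_repr x, Finsupp.linearCombination_apply, Finsupp.sum, map_sum,
    LinearMap.sum_apply, Finset.sum_eq_single p] at h
  · simpa [b', Basis.piTensorProduct_apply, tensorPairing_tprod, hv] using h
  · intro q hq hqp
    obtain ⟨i, hi⟩ := Function.ne_iff.mp hqp
    rw [map_smul, LinearMap.smul_apply, Basis.piTensorProduct_apply, tensorPairing_tprod,
      Finset.prod_eq_zero (Finset.mem_univ i), smul_zero]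
    exact hv' i _ (Finset.mem_biUnion.mpr ⟨q, hq, Finset.mem_image_of_mem _ (Finset.mem_univ i)⟩) hi
  · intro hp
    rw [Finsupp.notMem_support_iff.mp hp]
    simp

end TensorPower

/-! ### Tensors times shapes: the kernel before symmetrization -/

section ShapePairing

variable {K : Type*} [Field K] {A A' : Type*} [AddCommGroup A] [Module K A] [AddCommGroup A']
  [Module K A'] {Γ Δ : Type*}

/-- The tensor product of two pairings. -/
def shapePairing (b : A →ₗ[K] A' →ₗ[K] K) (C : (Γ →₀ K) →ₗ[K] (Δ →₀ K) →ₗ[K] K) :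
    (A ⊗[K] (Γ →₀ K)) →ₗ[K] (A' ⊗[K] (Δ →₀ K)) →ₗ[K] K :=
  TensorProduct.dualDistrib K A' (Δ →₀ K) ∘ₗ TensorProduct.map b C

theorem shapePairing_tmul (b : A →ₗ[K] A' →ₗ[K] K) (C : (Γ →₀ K) →ₗ[K] (Δ →₀ K) →ₗ[K] K)
    (w : A) (f : Γ →₀ K) (v : A') (g : Δ →₀ K) :
    shapePairing b C (w ⊗ₜ f) (v ⊗ₜ g) = b w v * C f g := rfl

theorem shapePairing_flip (b : A →ₗ[K] A' →ₗ[K] K) (C : (Γ →₀ K) →ₗ[K] (Δ →₀ K) →ₗ[K] K) :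
    (shapePairing b C).flip = shapePairing b.flip C.flip := by
  refine TensorProduct.ext' fun v g => TensorProduct.ext' fun w f => ?_
  simp only [LinearMap.flip_apply, shapePairing_tmul]

/-- The span of the products of arbitrary elements with elements of `rel`. -/
def tensorRelations (A : Type*) [AddCommGroup A] [Module K A] (rel : Submodule K (Γ →₀ K)) :
    Submodule K (A ⊗[K] (Γ →₀ K)) :=
  Submodule.span K {x | ∃ r ∈ rel, ∃ w : A, x = w ⊗ₜ[K] r}

theorem tensorRelations_le_ker {b : A →ₗ[K] A' →ₗ[K] K} {C : (Γ →₀ K) →ₗ[K] (Δ →₀ K) →ₗ[K] K}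
    {rel : Submodule K (Γ →₀ K)} (h : rel ≤ LinearMap.ker C) :
    tensorRelations A rel ≤ LinearMap.ker (shapePairing b C) := by
  refine Submodule.span_le.mpr ?_
  rintro _ ⟨r, hr, w, rfl⟩
  refine LinearMap.mem_ker.mpr (TensorProduct.ext' fun v g => ?_)
  rw [shapePairing_tmul, LinearMap.mem_ker.mp (h hr)]
  simp

/-- Modulo relations `x` is a sum of terms `a i ⊗ g i`. Pairing it with `v ⊗ t j` isolates `b (a j)
v`, so every `a j` vanishes by nondegeneracy of `b`. -/
theorem mem_tensorRelations {b : A →ₗ[K] A' →ₗ[K] K} (hb : b.SeparatingLeft)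
    {C : (Γ →₀ K) →ₗ[K] (Δ →₀ K) →ₗ[K] K} {rel : Submodule K (Γ →₀ K)}
    (hrel : rel ≤ LinearMap.ker C) {ι : Type*} {g : ι → Γ} {t : ι → Δ}
    (h₁ : ∀ i, C (Finsupp.single (g i) 1) (Finsupp.single (t i) 1) = 1)
    (h₀ : ∀ i j, i ≠ j → C (Finsupp.single (g i) 1) (Finsupp.single (t j) 1) = 0)
    (hspan : ∀ G, Finsupp.single G 1 ∈
      rel ⊔ Submodule.span K (Set.range fun i => Finsupp.single (g i) (1 : K)))
    {x : A ⊗[K] (Γ →₀ K)} (hx : shapePairing b C x = 0) : x ∈ tensorRelations A rel := by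
  classical
  let Θ : (ι →₀ A) →ₗ[K] A ⊗[K] (Γ →₀ K) :=
    Finsupp.lsum K fun i => (TensorProduct.mk K A (Γ →₀ K)).flip (Finsupp.single (g i) 1)
  have hΘ : ∀ i w, Θ (Finsupp.single i w) = w ⊗ₜ Finsupp.single (g i) 1 := by
    intro i w
    simp [Θ]
  have hsup : ∀ x, x ∈ tensorRelations A rel ⊔ LinearMap.range Θ := by
    have key : ∀ (f : Γ →₀ K), f ∈ rel ⊔ Submodule.span K
        (Set.range fun i => Finsupp.single (g i) (1 : K)) →
        ∀ w : A, w ⊗ₜ f ∈ tensorRelations A rel ⊔ LinearMap.range Θ := by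
      intro f hf w
      have hle : rel ⊔ Submodule.span K (Set.range fun i => Finsupp.single (g i) (1 : K)) ≤
          (tensorRelations A rel ⊔ LinearMap.range Θ).comap (TensorProduct.mk K A (Γ →₀ K) w) := by
        refine sup_le (fun r hr => Submodule.mem_sup_left (Submodule.subset_span ⟨r, hr, w, rfl⟩))
          (Submodule.span_le.mpr ?_)
        rintro _ ⟨i, rfl⟩
        exact Submodule.mem_sup_right ⟨_, hΘ i w⟩
      exact hle hf
    intro x
    induction x using TensorProduct.induction_on with
    | zero => exact zero_mem _
    | tmul w f =>
      refine key f ?_ w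
      induction f using Finsupp.induction_linear with
      | zero => exact zero_mem _
      | add f f' hf hf' => exact add_mem hf hf'
      | single G c =>
        rw [← mul_one c, ← smul_eq_mul, ← Finsupp.smul_single]
        exact Submodule.smul_mem _ _ (hspan G)
    | add x y hx hy => exact add_mem hx hy
  obtain ⟨r, hr, _, ⟨a, rfl⟩, rfl⟩ := Submodule.mem_sup.mp (hsup x)
  have hr0 : shapePairing b C r = 0 := tensorRelations_le_ker hrel hr
  rw [map_add, hr0, zero_add] at hx
  have ha : a = 0 := by
    ext j
    refine hb _ fun v => ?_
    have e : (shapePairing b C).flip (v ⊗ₜ Finsupp.single (t j) 1) ∘ₗ Θ =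
        b.flip v ∘ₗ Finsupp.lapply j := by
      refine Finsupp.lhom_ext fun i w => ?_
      simp only [LinearMap.comp_apply, hΘ, LinearMap.flip_apply, shapePairing_tmul,
        Finsupp.lapply_apply]
      by_cases hij : i = j
      · subst hij
        simp [h₁]
      · simp [h₀ i j hij, hij]
    have := congrArg (fun f => f a) e
    simpa [hx] using this.symm
  simpa [ha] using hr

end ShapePairing

/-! ### The signed action of the symmetric group -/

section Koszul

variable {K : Type*} [Field K] {W : Type*} [AddCommGroup W] [Module K W] {𝒲 : ℤ → Submodule K W}

/-- The projection to the sum of the homogeneous parts of even (`ε = true`) or odd degree. -/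
def parityProj (h𝒲 : DirectSum.IsInternal 𝒲) (ε : Bool) : W →ₗ[K] W :=
  DirectSum.toModule K ℤ W (fun i => if decide (Even i) = ε then (𝒲 i).subtype else 0) ∘ₗ
    (LinearEquiv.ofBijective (DirectSum.coeLinearMap 𝒲) h𝒲).symm.toLinearMap

theorem parityProj_of_mem (h𝒲 : DirectSum.IsInternal 𝒲) (ε : Bool) {i : ℤ} {w : W}
    (hw : w ∈ 𝒲 i) : parityProj h𝒲 ε w = if decide (Even i) = ε then w else 0 := by
  have : (LinearEquiv.ofBijective (DirectSum.coeLinearMap 𝒲) h𝒲).symm w =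
      DirectSum.lof K ℤ (fun i => 𝒲 i) i ⟨w, hw⟩ := by
    exact (LinearEquiv.symm_apply_eq _).mpr (DirectSum.coeLinearMap_lof 𝒲 i ⟨w, hw⟩).symm
  rw [parityProj, LinearMap.comp_apply, LinearEquiv.coe_coe, this, DirectSum.toModule_lof]
  split_ifs <;> rfl

variable {n : ℕ}

/-- The action of a permutation on a tensor power, with Koszul signs. -/
def koszulAction (h𝒲 : DirectSum.IsInternal 𝒲) (σ : Equiv.Perm (Fin n)) :
    (⨂[K] _ : Fin n, W) →ₗ[K] (⨂[K] _ : Fin n, W) :=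
  ∑ ε : Fin n → Bool, (koszulSign (fun i => if ε i then 0 else 1) σ : K) •
    ((PiTensorProduct.reindex K (fun _ => W) σ).toLinearMap ∘ₗ
      PiTensorProduct.map fun i => parityProj h𝒲 (ε i))

/-- Of the sum over parity patterns only the pattern of `w` survives, and the Koszul sign depends
only on parities. -/
theorem koszulAction_tprod (h𝒲 : DirectSum.IsInternal 𝒲) (σ : Equiv.Perm (Fin n))
    {d : Fin n → ℤ} {w : Fin n → W} (hw : ∀ i, w i ∈ 𝒲 (d i)) :
    koszulAction h𝒲 σ (PiTensorProduct.tprod K w) =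
      (koszulSign d σ : K) • PiTensorProduct.tprod K fun i => w (σ.symm i) := by
  have h : ∀ ε : Fin n → Bool, (PiTensorProduct.map fun i => parityProj h𝒲 (ε i))
      (PiTensorProduct.tprod K w) = if ε = fun i => decide (Even (d i)) then
        PiTensorProduct.tprod K w else 0 := by
    intro ε
    rw [PiTensorProduct.map_tprod]
    split_ifs with hε
    · subst hε
      congr 1
      ext i
      simp [parityProj_of_mem h𝒲 _ (hw i)]
    · obtain ⟨i, hi⟩ := Function.ne_iff.mp hε
      refine (PiTensorProduct.tprod K).map_coord_zero i ?_
      rw [parityProj_of_mem h𝒲 _ (hw i), if_neg (Ne.symm hi)]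
  simp only [koszulAction, LinearMap.sum_apply, LinearMap.smul_apply, LinearMap.comp_apply, h]
  rw [Finset.sum_eq_single fun i => decide (Even (d i))]
  · rw [if_pos rfl]
    congr 1
    · congr 1
      refine koszulSign_congr (fun i => ?_) σ
      by_cases hi : Even (d i) <;> simp [hi]
    · exact PiTensorProduct.reindex_tprod σ w
  · intro ε _ hε
    rw [if_neg hε, map_zero, smul_zero]
  · simp

theorem span_homogeneous (h𝒲 : DirectSum.IsInternal 𝒲) (n : ℕ) :
    Submodule.span K {x : ⨂[K] _ : Fin n, W | ∃ (d : Fin n → ℤ) (w : Fin n → W),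
      (∀ i, w i ∈ 𝒲 (d i)) ∧ x = PiTensorProduct.tprod K w} = ⊤ := by
  let b := h𝒲.collectedBasis fun i => Module.Basis.ofVectorSpace K (𝒲 i)
  rw [eq_top_iff, ← (Basis.piTensorProduct (ι := Fin n) fun _ => b).span_eq]
  refine Submodule.span_mono ?_
  rintro _ ⟨p, rfl⟩
  exact ⟨fun i => (p i).1, fun i => b (p i), fun i => h𝒲.collectedBasis_mem _ _,
    Basis.piTensorProduct_apply _ _⟩

variable {Γ : Type*}

theorem span_homogeneous_tmul (h𝒲 : DirectSum.IsInternal 𝒲) (n : ℕ) :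
    Submodule.span K {x : (⨂[K] _ : Fin n, W) ⊗[K] (Γ →₀ K) |
      ∃ (d : Fin n → ℤ) (w : Fin n → W) (G : Γ), (∀ i, w i ∈ 𝒲 (d i)) ∧
        x = PiTensorProduct.tprod K w ⊗ₜ Finsupp.single G 1} = ⊤ := by
  rw [eq_top_iff, ← TensorProduct.span_tmul_eq_top, Submodule.span_le]
  rintro _ ⟨a, f, rfl⟩
  have ha : a ∈ Submodule.span K {x : ⨂[K] _ : Fin n, W | ∃ (d : Fin n → ℤ) (w : Fin n → W),
      (∀ i, w i ∈ 𝒲 (d i)) ∧ x = PiTensorProduct.tprod K w} := by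
    rw [span_homogeneous h𝒲]
    trivial
  rw [SetLike.mem_coe]
  induction f using Finsupp.induction_linear with
  | zero => simp
  | add f f' hf hf' => rw [TensorProduct.tmul_add]; exact add_mem hf hf'
  | single G c =>
    rw [← mul_one c, ← smul_eq_mul, ← Finsupp.smul_single, TensorProduct.tmul_smul]
    refine Submodule.smul_mem _ _ ?_
    induction ha using Submodule.span_induction with
    | mem x hx =>
      obtain ⟨d, w, hw, rfl⟩ := hx
      exact Submodule.subset_span ⟨d, w, G, hw, rfl⟩
    | zero => simp
    | add x y _ _ hx hy => rw [TensorProduct.add_tmul]; exact add_mem hx hy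
    | smul a x _ hx => rw [← TensorProduct.smul_tmul']; exact Submodule.smul_mem _ a hx

theorem hom_ext_homogeneous (h𝒲 : DirectSum.IsInternal 𝒲) {Z : Type*} [AddCommGroup Z] [Module K Z]
    {f f' : ((⨂[K] _ : Fin n, W) ⊗[K] (Γ →₀ K)) →ₗ[K] Z}
    (h : ∀ (d : Fin n → ℤ) (w : Fin n → W) (G : Γ), (∀ i, w i ∈ 𝒲 (d i)) →
      f (PiTensorProduct.tprod K w ⊗ₜ Finsupp.single G 1) =
        f' (PiTensorProduct.tprod K w ⊗ₜ Finsupp.single G 1)) : f = f' := by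
  refine LinearMap.ext_on (span_homogeneous_tmul h𝒲 n) ?_
  rintro _ ⟨d, w, G, hw, rfl⟩
  exact h d w G hw

/-- The diagonal action on products of shapes and tensors. -/
def shapeAction (h𝒲 : DirectSum.IsInternal 𝒲) (act : Equiv.Perm (Fin n) → Γ → Γ)
    (σ : Equiv.Perm (Fin n)) :
    ((⨂[K] _ : Fin n, W) ⊗[K] (Γ →₀ K)) →ₗ[K] ((⨂[K] _ : Fin n, W) ⊗[K] (Γ →₀ K)) :=
  TensorProduct.map (koszulAction h𝒲 σ) (Finsupp.lmapDomain K K (act σ))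

theorem shapeAction_apply (h𝒲 : DirectSum.IsInternal 𝒲) (act : Equiv.Perm (Fin n) → Γ → Γ)
    (σ : Equiv.Perm (Fin n)) {d : Fin n → ℤ} {w : Fin n → W} (hw : ∀ i, w i ∈ 𝒲 (d i)) (G : Γ) :
    shapeAction h𝒲 act σ (PiTensorProduct.tprod K w ⊗ₜ Finsupp.single G 1) =
      (koszulSign d σ : K) • ((PiTensorProduct.tprod K fun i => w (σ.symm i)) ⊗ₜ[K]
        Finsupp.single (act σ G) (1 : K)) := by
  rw [shapeAction, TensorProduct.map_tmul, koszulAction_tprod h𝒲 σ hw, Finsupp.lmapDomain_apply,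
    Finsupp.mapDomain_single, TensorProduct.smul_tmul']

theorem shapeAction_mul (h𝒲 : DirectSum.IsInternal 𝒲) {act : Equiv.Perm (Fin n) → Γ → Γ}
    (hact : ∀ σ τ G, act (σ * τ) G = act σ (act τ G)) (σ τ : Equiv.Perm (Fin n)) :
    shapeAction h𝒲 act (σ * τ) = shapeAction h𝒲 act σ ∘ₗ shapeAction h𝒲 act τ := by
  refine hom_ext_homogeneous h𝒲 fun d w G hw => ?_
  rw [LinearMap.comp_apply, shapeAction_apply h𝒲 act _ hw, shapeAction_apply h𝒲 act _ hw, map_smul,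
    shapeAction_apply h𝒲 act (d := fun i => d (τ.symm i)) _ fun i => hw _, smul_smul, hact,
    koszulSign_mul]
  push_cast
  rw [mul_comm]
  rfl

theorem shapeAction_one (h𝒲 : DirectSum.IsInternal 𝒲) {act : Equiv.Perm (Fin n) → Γ → Γ}
    (hact : ∀ G, act 1 G = G) : shapeAction h𝒲 act 1 = LinearMap.id := by
  refine hom_ext_homogeneous h𝒲 fun d w G hw => ?_
  rw [shapeAction_apply h𝒲 act _ hw, koszulSign_one, hact, Int.cast_one, one_smul]
  rfl

/-- The relations which define the weight `n` summands, for an arbitrary kind of shapes. -/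
def koszulRelations (𝒲 : ℤ → Submodule K W) (rel : Submodule K (Γ →₀ K))
    (act : Equiv.Perm (Fin n) → Γ → Γ) : Submodule K ((⨂[K] _ : Fin n, W) ⊗[K] (Γ →₀ K)) :=
  Submodule.span K
    ({x | ∃ r ∈ rel, ∃ w : ⨂[K] _ : Fin n, W, x = w ⊗ₜ[K] r} ∪
     {x | ∃ (σ : Equiv.Perm (Fin n)) (G : Γ) (d : Fin n → ℤ) (w : Fin n → W),
        (∀ i, w i ∈ 𝒲 (d i)) ∧
        x = (koszulSign d σ : K) •
              ((PiTensorProduct.tprod K fun i => w (σ.symm i)) ⊗ₜ[K]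
                Finsupp.single (act σ G) (1 : K)) -
            PiTensorProduct.tprod K w ⊗ₜ[K] Finsupp.single G (1 : K)})

theorem shapeAction_sub_mem (h𝒲 : DirectSum.IsInternal 𝒲) (rel : Submodule K (Γ →₀ K))
    (act : Equiv.Perm (Fin n) → Γ → Γ) (σ : Equiv.Perm (Fin n))
    (x : (⨂[K] _ : Fin n, W) ⊗[K] (Γ →₀ K)) :
    shapeAction h𝒲 act σ x - x ∈ koszulRelations 𝒲 rel act := by
  have h : (koszulRelations 𝒲 rel act).mkQ ∘ₗ shapeAction h𝒲 act σ =
      (koszulRelations 𝒲 rel act).mkQ := by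
    refine hom_ext_homogeneous h𝒲 fun d w G hw => ?_
    rw [LinearMap.comp_apply, shapeAction_apply h𝒲 act _ hw]
    exact (Submodule.Quotient.eq _).mpr (Submodule.subset_span (.inr ⟨σ, G, d, w, hw, rfl⟩))
  exact (Submodule.Quotient.eq _).mp (congrArg (fun f => f x) h)

end Koszul

/-! ### The symmetrized pairing and its kernel -/

section Symmetrized

variable {K : Type*} [Field K] {W : Type*} [AddCommGroup W] [Module K W] {𝒲 : ℤ → Submodule K W}
  {V : Type*} [AddCommGroup V] [Module K V] {𝒱 : ℤ → Submodule K V} {n : ℕ} {Γ Δ : Type*}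

/-- The sum over all permutations `σ` of the pairings of `σ x` and `y`. -/
def symPairing (h𝒲 : DirectSum.IsInternal 𝒲) (B : W →ₗ[K] V →ₗ[K] K)
    (C : (Γ →₀ K) →ₗ[K] (Δ →₀ K) →ₗ[K] K) (act : Equiv.Perm (Fin n) → Γ → Γ) :
    ((⨂[K] _ : Fin n, W) ⊗[K] (Γ →₀ K)) →ₗ[K] ((⨂[K] _ : Fin n, V) ⊗[K] (Δ →₀ K)) →ₗ[K] K :=
  ∑ σ, shapePairing (tensorPairing B n) C ∘ₗ shapeAction h𝒲 act σ

theorem symPairing_apply (h𝒲 : DirectSum.IsInternal 𝒲) (B : W →ₗ[K] V →ₗ[K] K)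
    (C : (Γ →₀ K) →ₗ[K] (Δ →₀ K) →ₗ[K] K) (act : Equiv.Perm (Fin n) → Γ → Γ)
    (x : (⨂[K] _ : Fin n, W) ⊗[K] (Γ →₀ K)) (y : (⨂[K] _ : Fin n, V) ⊗[K] (Δ →₀ K)) :
    symPairing h𝒲 B C act x y =
      ∑ σ, shapePairing (tensorPairing B n) C (shapeAction h𝒲 act σ x) y := by
  simp [symPairing]

theorem symPairing_tmul (h𝒲 : DirectSum.IsInternal 𝒲) (B : W →ₗ[K] V →ₗ[K] K)
    (C : (Γ →₀ K) →ₗ[K] (Δ →₀ K) →ₗ[K] K) (act : Equiv.Perm (Fin n) → Γ → Γ)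
    {d : Fin n → ℤ} {w : Fin n → W} (hw : ∀ i, w i ∈ 𝒲 (d i)) (G : Γ) (v : Fin n → V) (T : Δ) :
    symPairing h𝒲 B C act (PiTensorProduct.tprod K w ⊗ₜ Finsupp.single G 1)
      (PiTensorProduct.tprod K v ⊗ₜ Finsupp.single T 1) =
      ∑ σ : Equiv.Perm (Fin n), (koszulSign d σ : K) *
        C (Finsupp.single (act σ G) 1) (Finsupp.single T 1) * ∏ i, B (w (σ.symm i)) (v i) := by
  rw [symPairing_apply]
  refine Finset.sum_congr rfl fun σ _ => ?_
  rw [shapeAction_apply h𝒲 act σ hw, map_smul, LinearMap.smul_apply, shapePairing_tmul,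
    tensorPairing_tprod, smul_eq_mul]
  ring

/-- For homogeneous tensors with equal degrees in all positions the same Koszul sign occurs twice
and squares to one. Otherwise some factor of the product is zero by `hdeg`. -/
theorem shapePairing_shapeAction (h𝒲 : DirectSum.IsInternal 𝒲) (h𝒱 : DirectSum.IsInternal 𝒱)
    {B : W →ₗ[K] V →ₗ[K] K} (hdeg : ∀ i j : ℤ, i ≠ j → ∀ w ∈ 𝒲 i, ∀ v ∈ 𝒱 j, B w v = 0)
    {C : (Γ →₀ K) →ₗ[K] (Δ →₀ K) →ₗ[K] K} {act : Equiv.Perm (Fin n) → Γ → Γ}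
    {act' : Equiv.Perm (Fin n) → Δ → Δ}
    (hC : ∀ σ G T, C (Finsupp.single (act σ G) 1) (Finsupp.single (act' σ T) 1) =
      C (Finsupp.single G 1) (Finsupp.single T 1)) (σ : Equiv.Perm (Fin n))
    (x : (⨂[K] _ : Fin n, W) ⊗[K] (Γ →₀ K)) (y : (⨂[K] _ : Fin n, V) ⊗[K] (Δ →₀ K)) :
    shapePairing (tensorPairing B n) C (shapeAction h𝒲 act σ x) (shapeAction h𝒱 act' σ y) =
      shapePairing (tensorPairing B n) C x y := by
  have h : (shapePairing (tensorPairing B n) C).compl₁₂ (shapeAction h𝒲 act σ)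
      (shapeAction h𝒱 act' σ) = shapePairing (tensorPairing B n) C := by
    refine hom_ext_homogeneous h𝒲 fun d w G hw => hom_ext_homogeneous h𝒱 fun d' v T hv => ?_
    rw [LinearMap.compl₁₂_apply, shapeAction_apply h𝒲 act σ hw, shapeAction_apply h𝒱 act' σ hv,
      map_smul, map_smul, LinearMap.smul_apply, shapePairing_tmul, shapePairing_tmul,
      tensorPairing_tprod, tensorPairing_tprod, hC,
      Equiv.prod_comp σ.symm (fun i => B (w i) (v i)), smul_smul]
    by_cases hd : d = d'
    · subst hd
      rw [← Int.cast_mul, koszulSign_mul_self, Int.cast_one, one_smul]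
    · obtain ⟨i, hi⟩ := Function.ne_iff.mp hd
      rw [Finset.prod_eq_zero (Finset.mem_univ i) (hdeg _ _ hi _ (hw i) _ (hv i))]
      simp
  exact congrArg (fun f => f x y) h

/-- By invariance, acting with `σ⁻¹` on one argument amounts to acting with `σ` on the other, so the
sum can be moved across. This makes the two sides of the pairing interchangeable. -/
theorem symPairing_flip (h𝒲 : DirectSum.IsInternal 𝒲) (h𝒱 : DirectSum.IsInternal 𝒱)
    {B : W →ₗ[K] V →ₗ[K] K} (hdeg : ∀ i j : ℤ, i ≠ j → ∀ w ∈ 𝒲 i, ∀ v ∈ 𝒱 j, B w v = 0)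
    {C : (Γ →₀ K) →ₗ[K] (Δ →₀ K) →ₗ[K] K} {act : Equiv.Perm (Fin n) → Γ → Γ}
    {act' : Equiv.Perm (Fin n) → Δ → Δ}
    (hC : ∀ σ G T, C (Finsupp.single (act σ G) 1) (Finsupp.single (act' σ T) 1) =
      C (Finsupp.single G 1) (Finsupp.single T 1))
    (hmul : ∀ σ τ T, act' (σ * τ) T = act' σ (act' τ T)) (hone : ∀ T, act' 1 T = T) :
    (symPairing h𝒲 B C act).flip = symPairing h𝒱 B.flip C.flip act' := by
  refine LinearMap.ext₂ fun y x => ?_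
  rw [LinearMap.flip_apply, symPairing_apply, symPairing_apply, ← tensorPairing_flip,
    ← shapePairing_flip, ← Equiv.sum_comp (Equiv.inv (Equiv.Perm (Fin n)))]
  refine Finset.sum_congr rfl fun σ _ => ?_
  have h : shapeAction h𝒱 act' σ⁻¹ (shapeAction h𝒱 act' σ y) = y := by
    rw [← LinearMap.comp_apply, ← shapeAction_mul h𝒱 hmul, inv_mul_cancel,
      shapeAction_one h𝒱 hone, LinearMap.id_apply]
  rw [Equiv.inv_apply, LinearMap.flip_apply]
  nth_rw 1 [← h]
  exact shapePairing_shapeAction h𝒲 h𝒱 hdeg hC _ _ _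

theorem symPairing_shapeAction (h𝒲 : DirectSum.IsInternal 𝒲) (B : W →ₗ[K] V →ₗ[K] K)
    (C : (Γ →₀ K) →ₗ[K] (Δ →₀ K) →ₗ[K] K) {act : Equiv.Perm (Fin n) → Γ → Γ}
    (hmul : ∀ σ τ G, act (σ * τ) G = act σ (act τ G)) (τ : Equiv.Perm (Fin n))
    (x : (⨂[K] _ : Fin n, W) ⊗[K] (Γ →₀ K)) :
    symPairing h𝒲 B C act (shapeAction h𝒲 act τ x) = symPairing h𝒲 B C act x := by
  refine LinearMap.ext fun y => ?_
  rw [symPairing_apply, symPairing_apply, ← Equiv.sum_comp (Equiv.mulRight τ)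
    (fun σ => shapePairing (tensorPairing B n) C (shapeAction h𝒲 act σ x) y)]
  refine Finset.sum_congr rfl fun σ _ => ?_
  rw [Equiv.coe_mulRight, shapeAction_mul h𝒲 hmul, LinearMap.comp_apply]

/-- The kernel of the symmetrized pairing consists of the relations. -/
theorem ker_symPairing [CharZero K] (h𝒲 : DirectSum.IsInternal 𝒲) (h𝒱 : DirectSum.IsInternal 𝒱)
    {B : W →ₗ[K] V →ₗ[K] K} (hB : B.SeparatingLeft)
    (hdeg : ∀ i j : ℤ, i ≠ j → ∀ w ∈ 𝒲 i, ∀ v ∈ 𝒱 j, B w v = 0)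
    {C : (Γ →₀ K) →ₗ[K] (Δ →₀ K) →ₗ[K] K} {rel : Submodule K (Γ →₀ K)}
    (hrel : rel ≤ LinearMap.ker C) {ι : Type*} {g : ι → Γ} {t : ι → Δ}
    (h₁ : ∀ i, C (Finsupp.single (g i) 1) (Finsupp.single (t i) 1) = 1)
    (h₀ : ∀ i j, i ≠ j → C (Finsupp.single (g i) 1) (Finsupp.single (t j) 1) = 0)
    (hspan : ∀ G, Finsupp.single G 1 ∈
      rel ⊔ Submodule.span K (Set.range fun i => Finsupp.single (g i) (1 : K)))
    {act : Equiv.Perm (Fin n) → Γ → Γ} {act' : Equiv.Perm (Fin n) → Δ → Δ}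
    (hC : ∀ σ G T, C (Finsupp.single (act σ G) 1) (Finsupp.single (act' σ T) 1) =
      C (Finsupp.single G 1) (Finsupp.single T 1))
    (hmul : ∀ σ τ G, act (σ * τ) G = act σ (act τ G))
    (hmul' : ∀ σ τ T, act' (σ * τ) T = act' σ (act' τ T)) (hone' : ∀ T, act' 1 T = T) :
    koszulRelations 𝒲 rel act = LinearMap.ker (symPairing h𝒲 B C act) := by
  refine le_antisymm (Submodule.span_le.mpr ?_) fun x hx => ?_
  · rintro _ (⟨r, hr, w, rfl⟩ | ⟨σ, G, d, w, hw, rfl⟩)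
    · refine LinearMap.mem_ker.mpr (LinearMap.ext fun y => ?_)
      have h0 : shapePairing (tensorPairing B n) C (w ⊗ₜ r) = 0 :=
        tensorRelations_le_ker hrel (Submodule.subset_span ⟨r, hr, w, rfl⟩)
      -- With the sum moved to the other argument, `w ⊗ r` itself is paired, and stability of `rel`
      -- under `act` is not needed.
      rw [← LinearMap.flip_apply, symPairing_flip h𝒲 h𝒱 hdeg hC hmul' hone', symPairing_apply,
        ← tensorPairing_flip, ← shapePairing_flip]
      simp [h0]
    · rw [← shapeAction_apply h𝒲 act σ hw, SetLike.mem_coe, LinearMap.mem_ker, map_sub,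
        symPairing_shapeAction h𝒲 B C hmul, sub_self]
  · have hN : ∑ σ, shapeAction h𝒲 act σ x ∈ koszulRelations 𝒲 rel act := by
      refine (Submodule.span_mono Set.subset_union_left : tensorRelations _ rel ≤ _)
        (mem_tensorRelations (tensorPairing_separatingLeft hB n) hrel h₁ h₀ hspan ?_)
      refine LinearMap.ext fun y => ?_
      rw [map_sum, LinearMap.sum_apply, ← symPairing_apply, LinearMap.mem_ker.mp hx]
    have hsub : ∑ σ : Equiv.Perm (Fin n), (shapeAction h𝒲 act σ x - x) ∈
        koszulRelations 𝒲 rel act :=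
      sum_mem fun σ _ => shapeAction_sub_mem h𝒲 rel act σ x
    have hx' := sub_mem hN hsub
    -- The difference of the two sums is `n! x`, and `n!` is invertible in characteristic zero.
    rw [Finset.sum_sub_distrib, sub_sub_cancel, Finset.sum_const, ← Nat.cast_smul_eq_nsmul K] at hx'
    refine (Submodule.smul_mem_iff _ ?_).mp hx'
    simp [Fintype.card_perm, Nat.factorial_ne_zero]

end Symmetrized

/-! ### The perfect pairing in a fixed weight -/

section Weight

theorem exists_quotient_pairing {K X Y : Type*} [Field K] [AddCommGroup X] [Module K X]
    [AddCommGroup Y] [Module K Y] (P : X →ₗ[K] Y →ₗ[K] K) {R : Submodule K X} {R' : Submodule K Y}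
    (hR : R = LinearMap.ker P) (hR' : R' = LinearMap.ker P.flip) :
    ∃ Φ : (X ⧸ R) →ₗ[K] (Y ⧸ R') →ₗ[K] K,
      (∀ x y, Φ (R.mkQ x) (R'.mkQ y) = P x y) ∧ Φ.Nondegenerate := by
  let Φ₁ : (X ⧸ R) →ₗ[K] Y →ₗ[K] K := R.liftQ P hR.le
  have h₁ : R' ≤ LinearMap.ker Φ₁.flip := by
    intro y hy
    rw [hR'] at hy
    refine LinearMap.mem_ker.mpr (LinearMap.ext fun x => ?_)
    obtain ⟨x, rfl⟩ := R.mkQ_surjective x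
    exact congrArg (fun f => f x) (LinearMap.mem_ker.mp hy)
  let Φ : (X ⧸ R) →ₗ[K] (Y ⧸ R') →ₗ[K] K := (R'.liftQ Φ₁.flip h₁).flip
  have hΦ : ∀ x y, Φ (R.mkQ x) (R'.mkQ y) = P x y := fun x y => rfl
  refine ⟨Φ, hΦ, fun x hx => ?_, fun y hy => ?_⟩
  · obtain ⟨x, rfl⟩ := R.mkQ_surjective x
    refine (Submodule.Quotient.mk_eq_zero _).mpr ?_
    rw [hR]
    exact LinearMap.mem_ker.mpr (LinearMap.ext fun y => hx (R'.mkQ y))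
  · obtain ⟨y, rfl⟩ := R'.mkQ_surjective y
    refine (Submodule.Quotient.mk_eq_zero _).mpr ?_
    rw [hR']
    exact LinearMap.mem_ker.mpr (LinearMap.ext fun x => hy (R.mkQ x))

variable {K : Type*} [Field K] {W : Type*} [AddCommGroup W] [Module K W] {𝒲 : ℤ → Submodule K W}
  {V : Type*} [AddCommGroup V] [Module K V] {𝒱 : ℤ → Submodule K V}

theorem configForm_relabel (n : ℕ) (σ : Equiv.Perm (Fin n)) (G : SGraph (Fin n))
    (T : STree (Fin n)) : configForm K n (Finsupp.single (G.relabel σ) 1)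
      (Finsupp.single (T.relabel σ) 1) = configForm K n (Finsupp.single G 1)
        (Finsupp.single T 1) := by
  rw [configForm_single, configForm_single, configPairing_relabel]

/-- The configuration pairing in weight `n`. -/
theorem exists_weight_pairing [CharZero K] (h𝒲 : DirectSum.IsInternal 𝒲)
    (h𝒱 : DirectSum.IsInternal 𝒱) {B : W →ₗ[K] V →ₗ[K] K}
    (hdeg : ∀ i j : ℤ, i ≠ j → ∀ w ∈ 𝒲 i, ∀ v ∈ 𝒱 j, B w v = 0) (hB : B.Nondegenerate) (n : ℕ) :
    ∃ Φ : EWeight 𝒲 n →ₗ[K] LWeight 𝒱 n →ₗ[K] K,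
      (∀ x y, Φ (EWeight.mk 𝒲 n x) (LWeight.mk 𝒱 n y) =
        symPairing h𝒲 B (configForm K n) (fun σ G => G.relabel σ) x y) ∧ Φ.Nondegenerate := by
  obtain ⟨ι, g, t, h₁, h₀, hg, ht⟩ := exists_dual_families K n
  have hC := configForm_relabel (K := K) n
  refine exists_quotient_pairing
    (symPairing h𝒲 B (configForm K n) (fun σ (G : SGraph (Fin n)) => G.relabel σ))
    (R := eRelations 𝒲 n) (R' := lRelations 𝒱 n) ?_ ?_
  -- By definition `eRelations` and `lRelations` are the `koszulRelations` for graphs and for trees.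
  · exact ker_symPairing h𝒲 h𝒱 hB.1 hdeg eilRelations_le_ker h₁ h₀ hg hC
      SGraph.relabel_mul STree.relabel_mul STree.relabel_one
  · rw [symPairing_flip h𝒲 h𝒱 hdeg hC STree.relabel_mul STree.relabel_one]
    exact ker_symPairing h𝒱 h𝒲 (LinearMap.flip_separatingLeft.mpr hB.2)
      (fun i j hij v hv w hw => hdeg j i hij.symm w hw v hv) lieRelations_le_ker
      h₁ (fun i j hij => h₀ j i hij.symm) ht (fun σ T G => hC σ G T)
      STree.relabel_mul SGraph.relabel_mul SGraph.relabel_one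

end Weight

/-! ### Sum over the weights, degrees and finiteness -/

section Total

variable {K : Type*} [Field K] {W : Type*} [AddCommGroup W] [Module K W] {𝒲 : ℤ → Submodule K W}

theorem eBar_hom_ext (h𝒲 : DirectSum.IsInternal 𝒲) {Z : Type*} [AddCommGroup Z] [Module K Z]
    {f f' : EBar 𝒲 →ₗ[K] Z}
    (h : ∀ (n : ℕ) (G : SGraph (Fin n)) (d : Fin n → ℤ) (w : Fin n → W), (∀ i, w i ∈ 𝒲 (d i)) →
      f (eClass 𝒲 G w) = f' (eClass 𝒲 G w)) : f = f' := by
  refine DirectSum.linearMap_ext K fun n => ?_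
  refine (LinearMap.cancel_right (Submodule.mkQ_surjective (eRelations 𝒲 n))).mp ?_
  exact hom_ext_homogeneous h𝒲 fun d w G hw => h n G d w hw

theorem lBar_hom_ext (h𝒲 : DirectSum.IsInternal 𝒲) {Z : Type*} [AddCommGroup Z] [Module K Z]
    {f f' : LBar 𝒲 →ₗ[K] Z}
    (h : ∀ (n : ℕ) (T : STree (Fin n)) (d : Fin n → ℤ) (w : Fin n → W), (∀ i, w i ∈ 𝒲 (d i)) →
      f (lClass 𝒲 T w) = f' (lClass 𝒲 T w)) : f = f' := by
  refine DirectSum.linearMap_ext K fun n => ?_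
  refine (LinearMap.cancel_right (Submodule.mkQ_surjective (lRelations 𝒲 n))).mp ?_
  exact hom_ext_homogeneous h𝒲 fun d w T hw => h n T d w hw

instance (n : ℕ) : Finite (SGraph (Fin n)) :=
  Finite.of_injective SGraph.edges fun _ _ => SGraph.ext

instance [Module.Finite K W] (n : ℕ) : Module.Finite K (EWeight 𝒲 n) :=
  Module.Finite.of_surjective (EWeight.mk 𝒲 n) (Submodule.mkQ_surjective _)

/-- A nonzero class of degree `m` has at most `m` factors, each of degree between `1` and `m`.
Finitely many weights and the finite-dimensional space `W'` therefore account for the whole degree.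
-/
theorem finite_eDegree (hfin : ∀ i : ℤ, Module.Finite K (𝒲 i)) (hpos : ∀ i ≤ 0, 𝒲 i = ⊥) (m : ℤ) :
    Module.Finite K (eDegree 𝒲 m) := by
  let W' : Submodule K W := ⨆ i ∈ Finset.Icc 1 m, 𝒲 i
  have hW' : Module.Finite K W' :=
    Module.Finite.iff_fg.mpr (Submodule.fg_biSup _ _ fun i _ => Module.Finite.iff_fg.mp (hfin i))
  let θ : ∀ n : ℕ, ((⨂[K] _ : Fin n, W') ⊗[K] Gr K n) →ₗ[K] EBar 𝒲 := fun n =>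
    DirectSum.lof K ℕ (EWeight 𝒲) n ∘ₗ EWeight.mk 𝒲 n ∘ₗ
      TensorProduct.map (PiTensorProduct.map fun _ => W'.subtype) LinearMap.id
  let F : Submodule K (EBar 𝒲) := ⨆ n ∈ Finset.range (m.toNat + 1), LinearMap.range (θ n)
  have hF : Module.Finite K F :=
    Module.Finite.iff_fg.mpr (Submodule.fg_biSup _ _ fun n _ =>
      Module.Finite.iff_fg.mp (Module.Finite.range (θ n)))
  refine Submodule.finiteDimensional_of_le (S₂ := F) (Submodule.span_le.mpr ?_)
  rintro _ ⟨n, G, d, w, hw, hd, rfl⟩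
  by_cases hdpos : ∀ i, 0 < d i
  · have hle : ∀ i, d i ≤ m := fun i =>
      hd ▸ Finset.single_le_sum (fun j _ => (hdpos j).le) (Finset.mem_univ i)
    have hn : n ∈ Finset.range (m.toNat + 1) := by
      have : (n : ℤ) ≤ m := by
        rw [← hd]
        calc (n : ℤ) = ∑ _i : Fin n, (1 : ℤ) := by simp
          _ ≤ ∑ i, d i := Finset.sum_le_sum fun i _ => hdpos i
      rw [Finset.mem_range]
      omega
    have hwW' : ∀ i, w i ∈ W' := fun i =>
      (le_biSup 𝒲 (Finset.mem_Icc.mpr ⟨hdpos i, hle i⟩) : 𝒲 (d i) ≤ W') (hw i)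
    refine (le_biSup (fun n => LinearMap.range (θ n)) hn : _ ≤ F) ?_
    refine ⟨PiTensorProduct.tprod K (fun i => (⟨w i, hwW' i⟩ : W')) ⊗ₜ Finsupp.single G 1, ?_⟩
    simp only [θ, LinearMap.comp_apply, TensorProduct.map_tmul, PiTensorProduct.map_tprod]
    rfl
  -- A factor of nonpositive degree is zero, and so is the class.
  · push Not at hdpos
    obtain ⟨i, hi⟩ := hdpos
    have hwi : w i = 0 := by
      have := hw i
      rwa [hpos _ hi, Submodule.mem_bot] at this
    rw [eClass, (PiTensorProduct.tprod K).map_coord_zero i hwi, TensorProduct.zero_tmul, map_zero,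
      map_zero]
    exact zero_mem _

variable {V : Type*} [AddCommGroup V] [Module K V] {𝒱 : ℤ → Submodule K V}
  {B : W →ₗ[K] V →ₗ[K] K} {Φ : EBar 𝒲 →ₗ[K] LBar 𝒱 →ₗ[K] K}

theorem IsConfigurationPairing.unique (h𝒲 : DirectSum.IsInternal 𝒲) (h𝒱 : DirectSum.IsInternal 𝒱)
    {Ψ : EBar 𝒲 →ₗ[K] LBar 𝒱 →ₗ[K] K} (hΦ : IsConfigurationPairing 𝒲 𝒱 B Φ)
    (hΨ : IsConfigurationPairing 𝒲 𝒱 B Ψ) : Ψ = Φ := by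
  refine eBar_hom_ext h𝒲 fun n G d w hw => lBar_hom_ext h𝒱 fun m T d' v hv => ?_
  by_cases h : n = m
  · subst h
    rw [hΦ.1 n G T d w v hw, hΨ.1 n G T d w v hw]
  · rw [hΦ.2 n m h G T w v, hΨ.2 n m h G T w v]

theorem IsConfigurationPairing.eq_zero_of_degree_ne (hΦ : IsConfigurationPairing 𝒲 𝒱 B Φ)
    (hdeg : ∀ i j : ℤ, i ≠ j → ∀ w ∈ 𝒲 i, ∀ v ∈ 𝒱 j, B w v = 0) {n m : ℕ} (G : SGraph (Fin n))
    (T : STree (Fin m)) {d : Fin n → ℤ} {d' : Fin m → ℤ} {w : Fin n → W} {v : Fin m → V}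
    (hw : ∀ i, w i ∈ 𝒲 (d i)) (hv : ∀ i, v i ∈ 𝒱 (d' i)) (hne : ∑ i, d i ≠ ∑ i, d' i) :
    Φ (eClass 𝒲 G w) (lClass 𝒱 T v) = 0 := by
  by_cases h : n = m
  · subst h
    rw [hΦ.1 n G T d w v hw]
    refine Finset.sum_eq_zero fun σ _ => ?_
    have : ∃ i, d (σ.symm i) ≠ d' i := by
      by_contra! hd
      exact hne (by rw [← Equiv.sum_comp σ.symm]; exact Finset.sum_congr rfl fun i _ => hd i)
    obtain ⟨i, hi⟩ := this
    rw [Finset.prod_eq_zero (Finset.mem_univ i) (hdeg _ _ hi _ (hw _) _ (hv i)), mul_zero]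
  · exact hΦ.2 n m h G T w v

theorem IsConfigurationPairing.eDegree_lDegree (hΦ : IsConfigurationPairing 𝒲 𝒱 B Φ)
    (hdeg : ∀ i j : ℤ, i ≠ j → ∀ w ∈ 𝒲 i, ∀ v ∈ 𝒱 j, B w v = 0) {k l : ℤ} (hkl : k ≠ l)
    {x : EBar 𝒲} (hx : x ∈ eDegree 𝒲 k) {y : LBar 𝒱} (hy : y ∈ lDegree 𝒱 l) : Φ x y = 0 := by
  have hle : eDegree 𝒲 k ≤ LinearMap.ker ((Φ.compl₂ (lDegree 𝒱 l).subtype)) := by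
    refine Submodule.span_le.mpr ?_
    rintro _ ⟨n, G, d, w, hw, rfl, rfl⟩
    refine LinearMap.mem_ker.mpr (LinearMap.ext fun y => ?_)
    have hle' : lDegree 𝒱 l ≤ LinearMap.ker (Φ (eClass 𝒲 G w)) := by
      refine Submodule.span_le.mpr ?_
      rintro _ ⟨m, T, d', v, hv, rfl, rfl⟩
      exact hΦ.eq_zero_of_degree_ne hdeg G T hw hv hkl
    exact hle' y.2
  exact congrArg (fun f => f ⟨y, hy⟩) (LinearMap.mem_ker.mp (hle hx))

/-- Different degrees are orthogonal, so an element of degree `m` orthogonal to the opposite degree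
`m` part is orthogonal to everything. -/
theorem IsConfigurationPairing.nondegenerate_degree (h𝒲 : DirectSum.IsInternal 𝒲)
    (h𝒱 : DirectSum.IsInternal 𝒱) (hΦ : IsConfigurationPairing 𝒲 𝒱 B Φ)
    (hdeg : ∀ i j : ℤ, i ≠ j → ∀ w ∈ 𝒲 i, ∀ v ∈ 𝒱 j, B w v = 0) (hnd : Φ.Nondegenerate) (m : ℤ) :
    (Φ.domRestrict₁₂ (eDegree 𝒲 m) (lDegree 𝒱 m)).Nondegenerate := by
  refine ⟨fun x hx => ?_, fun y hy => ?_⟩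
  · refine Subtype.ext (hnd.1 _ fun y => ?_)
    refine congrArg (fun f => f y) (lBar_hom_ext h𝒱 (f := Φ x.1) (f' := 0) fun n T d v hv => ?_)
    have hmem : lClass 𝒱 T v ∈ lDegree 𝒱 (∑ i, d i) :=
      Submodule.subset_span ⟨n, T, d, v, hv, rfl, rfl⟩
    by_cases h : m = ∑ i, d i
    · exact hx ⟨_, h ▸ hmem⟩
    · exact hΦ.eDegree_lDegree hdeg h x.2 hmem
  · refine Subtype.ext (hnd.2 _ fun x => ?_)
    refine congrArg (fun f => f x) (eBar_hom_ext h𝒲 (f := Φ.flip y.1) (f' := 0)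
      fun n G d w hw => ?_)
    have hmem : eClass 𝒲 G w ∈ eDegree 𝒲 (∑ i, d i) :=
      Submodule.subset_span ⟨n, G, d, w, hw, rfl, rfl⟩
    by_cases h : m = ∑ i, d i
    · exact hy ⟨_, h ▸ hmem⟩
    · exact hΦ.eDegree_lDegree hdeg (Ne.symm h) hmem y.2

/-- Each space embeds in the dual of the other, so finite dimension of `X` forces that of `Y`, and
equal dimensions make both embeddings isomorphisms. -/
theorem isPerfPair_of_nondegenerate {X Y : Type*} [AddCommGroup X] [Module K X] [AddCommGroup Y]
    [Module K Y] [Module.Finite K X] {P : X →ₗ[K] Y →ₗ[K] K} (hP : P.Nondegenerate) :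
    P.IsPerfPair :=
  .of_injective (LinearMap.ker_eq_bot.mp (LinearMap.separatingLeft_iff_ker_eq_bot.mp hP.1))
    (LinearMap.ker_eq_bot.mp (LinearMap.separatingRight_iff_flip_ker_eq_bot.mp hP.2))

/-- The pairing of two direct sums which is given on the summands and vanishes on summands with
different indices. -/
def sumPairing {X Y : ℕ → Type*} [∀ n, AddCommGroup (X n)] [∀ n, Module K (X n)]
    [∀ n, AddCommGroup (Y n)] [∀ n, Module K (Y n)] (P : ∀ n, X n →ₗ[K] Y n →ₗ[K] K) :
    (⨁ n, X n) →ₗ[K] (⨁ n, Y n) →ₗ[K] K :=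
  DirectSum.toModule K ℕ _ fun n => (P n).compl₂ (DirectSum.component K ℕ Y n)

section SumPairing

variable {X Y : ℕ → Type*} [∀ n, AddCommGroup (X n)] [∀ n, Module K (X n)]
  [∀ n, AddCommGroup (Y n)] [∀ n, Module K (Y n)] (P : ∀ n, X n →ₗ[K] Y n →ₗ[K] K)

theorem sumPairing_lof (n : ℕ) (x : X n) (y : ⨁ n, Y n) :
    sumPairing P (DirectSum.lof K ℕ X n x) y = P n x (y n) := by
  rw [sumPairing, DirectSum.toModule_lof]
  rfl

theorem sumPairing_apply_lof (n : ℕ) (x : ⨁ n, X n) (y : Y n) :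
    sumPairing P x (DirectSum.lof K ℕ Y n y) = P n (x n) y := by
  have h : (sumPairing P).flip (DirectSum.lof K ℕ Y n y) =
      (P n).flip y ∘ₗ DirectSum.component K ℕ X n := by
    refine DirectSum.linearMap_ext K fun m => LinearMap.ext fun x => ?_
    rw [LinearMap.comp_apply, LinearMap.flip_apply, sumPairing_lof, LinearMap.comp_apply,
      LinearMap.comp_apply, LinearMap.flip_apply]
    by_cases hmn : m = n
    · subst hmn
      rw [DirectSum.component.lof_self, DirectSum.lof_apply]
    · rw [DirectSum.component.of, dif_neg hmn, DirectSum.lof_eq_of,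
        DirectSum.of_eq_of_ne _ _ _ hmn]
      simp
  exact congrArg (fun f => f x) h

theorem sumPairing_nondegenerate (hP : ∀ n, (P n).Nondegenerate) :
    (sumPairing P).Nondegenerate := by
  refine ⟨fun x hx => DFinsupp.ext fun n => (hP n).1 _ fun y => ?_,
    fun y hy => DFinsupp.ext fun n => (hP n).2 _ fun x => ?_⟩
  · rw [← sumPairing_apply_lof]
    exact hx _
  · rw [← sumPairing_lof]
    exact hy _

end SumPairing

end Total

end LieGraph

end

open LieGraph in
theorem mainTheorem5 {K : Type*} [Field K] [CharZero K]
    {W : Type*} [AddCommGroup W] [Module K W] {V : Type*} [AddCommGroup V] [Module K V]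
    (𝒲 : ℤ → Submodule K W) (𝒱 : ℤ → Submodule K V)
    (h𝒲 : DirectSum.IsInternal 𝒲) (h𝒱 : DirectSum.IsInternal 𝒱)
    (B : W →ₗ[K] V →ₗ[K] K)
    (hdeg : ∀ i j : ℤ, i ≠ j → ∀ w ∈ 𝒲 i, ∀ v ∈ 𝒱 j, B w v = 0)
    (hB : B.Nondegenerate) :
    ∃ Φ : EBar 𝒲 →ₗ[K] LBar 𝒱 →ₗ[K] K,
      (IsConfigurationPairing 𝒲 𝒱 B Φ ∧
        ∀ Ψ : EBar 𝒲 →ₗ[K] LBar 𝒱 →ₗ[K] K, IsConfigurationPairing 𝒲 𝒱 B Ψ → Ψ = Φ) ∧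
      Φ.Nondegenerate ∧
      (Module.Finite K W → Module.Finite K V → ∀ n : ℕ,
        (Φ.compl₁₂ (DirectSum.lof K ℕ (EWeight 𝒲) n)
          (DirectSum.lof K ℕ (LWeight 𝒱) n)).IsPerfPair) ∧
      ((∀ i : ℤ, Module.Finite K (𝒲 i)) → (∀ i : ℤ, Module.Finite K (𝒱 i)) →
        (∀ i ≤ 0, 𝒲 i = ⊥) → (∀ i ≤ 0, 𝒱 i = ⊥) → ∀ m : ℤ,
        (Φ.domRestrict₁₂ (eDegree 𝒲 m) (lDegree 𝒱 m)).IsPerfPair) := by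
  choose P hP hnd using exists_weight_pairing h𝒲 h𝒱 hdeg hB
  have hΦ : IsConfigurationPairing 𝒲 𝒱 B (sumPairing P) := by
    refine ⟨fun n G T d w v hw => ?_, fun m n hmn G T w v => ?_⟩
    · rw [eClass, lClass, sumPairing_lof, DirectSum.lof_apply, hP, symPairing_tmul h𝒲 B _ _ hw]
      simp only [configForm_single]
    · rw [eClass, lClass, sumPairing_lof, DirectSum.lof_eq_of, DirectSum.of_eq_of_ne _ _ _ hmn,
        map_zero]
  have hndΦ := sumPairing_nondegenerate P hnd
  refine ⟨sumPairing P, ⟨hΦ, fun Ψ hΨ => hΦ.unique h𝒲 h𝒱 hΨ⟩, hndΦ, fun _ _ n => ?_,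
    fun hW _ hpos _ m => ?_⟩
  · have : (sumPairing P).compl₁₂ (DirectSum.lof K ℕ (EWeight 𝒲) n)
        (DirectSum.lof K ℕ (LWeight 𝒱) n) = P n := by
      refine LinearMap.ext₂ fun x y => ?_
      rw [LinearMap.compl₁₂_apply, sumPairing_lof, DirectSum.lof_apply]
    rw [this]
    exact isPerfPair_of_nondegenerate (hnd n)
  · have := finite_eDegree hW hpos m
    exact isPerfPair_of_nondegenerate (hΦ.nondegenerate_degree h𝒲 h𝒱 hdeg hndΦ m)
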